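/- **Setting.** Let $\mathcal X$ and $\Phi$ be Polish spaces equipped with countably generated $\sigma$-algebras, $\mathcal Y=\mathcal X\times\Phi$ with the product topology and product $\sigma$-algebra $\mathcal F_{\mathcal Y}$, $\mathcal I$ a measurable space, and $\nu$ a probability measure on $\mathcal X$. Let $(y,\gamma,A)\mapsto P_\gamma(y,A)$ be a Markov (probability) kernel from $\mathcal Y\times\mathcal I$ to $\mathcal Y$, and for each $\gamma\in\mathcal I$ let $\pi_\gamma$ be a probability measure on $\mathcal Y$ that is invariant for $P_\gamma$ and satisfies $\pi_\gamma(B\times\Phi)=\nu(B)$ for all measurable $B\subseteq\mathcal X$. *Simultaneous drift and minorisation.* Let $V:\mathcal Y\to[1,\infty)$ be measurable and lower semi-continuous, and suppose that there are $C\in\mathcal F_{\mathcal Y}$ and real numbers $\kappa\in(0,1)$, $\delta>0$, $b$ with $\sup_{x\in C}V(x)<\infty$ such that for every $\gamma\in\mathcal I$: (i) $P_\gamma V(y)\le\kappa V(y)+b\,\mathbf 1_C(y)$ for all $y\in\mathcal Y$; (ii) there is a probability measure $\eta_\gamma$ on $C$ with $P_\gamma(x,A)\ge\delta\,\eta_\gamma(A\cap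 C)$ for all $x\in C$ and $A\in\mathcal F_{\mathcal Y}$. *Adaptive increasingly rare (AIR) chain.* Let $\beta>0$ and $T_m=\sum_{j=1}^m\lceil j^\beta\rceil$ for $m\ge0$ (so $T_0=0$). On a probability space $(\Omega,\mathcal F,\mathbb P)$ let $Y_n=(X_n,\phi_n)$ and $\Gamma_n$, $n\ge0$, be random variables with values in $\mathcal Y$ and $\mathcal I$, and let $\mathcal F_n=\sigma(Y_0,\dots,Y_n,\Gamma_0,\dots,\Gamma_n)$. Assume, with all equalities between random variables understood almost surely, that * $(Y_0,\Gamma_0)=(y_0,\gamma_0)$ for some fixed $y_0\in\mathcal Y$, $\gamma_0\in\mathcal I$; * $\mathbb P[Y_{n+1}\in B\mid\mathcal F_n]=P_{\Gamma_n}(Y_n,B)$ for all $n\ge 0$ and $B\in\mathcal F_{\mathcal Y}$; * $\Gamma_n=U_n(Y_0,\dots,Y_n,\Gamma_0,\dots,\Gamma_{n-1})$ for some measurable $U_n:\mathcal Y^{n+1}\times\mathcal I^n\to\mathcal I$, for all $n\ge0$; * $\Gamma_{i_1}=\Gamma_{i_2}$ whenever $T_j\le i_1,i_2<T_{j+1}$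 for some $j\ge0$. **Theorem.** Let $p>2$ and let $f:\mathcal X\to\mathbb R$ be measurable with $|f(x)|\le V(x,\varphi)^{1/p}$ for all $(x,\varphi)\in\mathcal X\times\Phi$. Then $f$ is $\nu$-integrable, and for every $$\varepsilon>\max\Bigl\{0,\ \frac1{1+\beta}+\frac1p-\frac12\Bigr\}$$ we have, $\mathbb P$-almost surely, $$\lim_{n\to\infty}\frac1{n^{1/2+\varepsilon}}\sum_{j=1}^n\bigl(f(X_j)-\nu(f)\bigr)=0,\qquad \nu(f)=\int_{\mathcal X}f\,\mathrm d\nu .$$ -/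

import Mathlib

open MeasureTheory ProbabilityTheory Filter Topology

namespace AIRMCMC

section Kernels

variable {𝒴 𝓘 : Type*} [MeasurableSpace 𝒴] [MeasurableSpace 𝓘]

/-- Simultaneous drift and minorisation for the kernels `P_γ(y, ·) = P (y, γ)`, with drift function
`V : 𝒴 → [1, ∞)`. The set `C` and the numbers `κ, δ, b, v` do not depend on `γ`; only the
minorising probability measure `η` (which is carried by `C`) may. The integral `P_γ V (y)` is the
`[0, ∞]`-valued one, so its finiteness is part of the drift inequality. -/
def DriftMinorisation [TopologicalSpace 𝒴] (P : Kernel (𝒴 × 𝓘) 𝒴) (V : 𝒴 → ℝ) : Prop :=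
  LowerSemicontinuous V ∧ Measurable V ∧ (∀ y, 1 ≤ V y) ∧
  ∃ (C : Set 𝒴) (κ δ b v : ℝ), MeasurableSet C ∧ 0 < κ ∧ κ < 1 ∧ 0 < δ ∧
    (∀ y ∈ C, V y ≤ v) ∧
    ∀ γ : 𝓘,
      (∀ y, ∫⁻ z, ENNReal.ofReal (V z) ∂(P (y, γ))
          ≤ ENNReal.ofReal (κ * V y + C.indicator (fun _ => b) y)) ∧
      ∃ η : Measure 𝒴, IsProbabilityMeasure η ∧ η Cᶜ = 0 ∧
        ∀ x ∈ C, ∀ A : Set 𝒴, MeasurableSet A →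
          ENNReal.ofReal δ * η (A ∩ C) ≤ P (x, γ) A

/-- Each `π γ` is a probability measure on `𝒳 × Φ` that is invariant for `P_γ` and has
`𝒳`-marginal `ν`. -/
structure HasTarget {𝒳 Φ : Type*} [MeasurableSpace 𝒳] [MeasurableSpace Φ]
    (P : Kernel ((𝒳 × Φ) × 𝓘) (𝒳 × Φ)) (π : 𝓘 → Measure (𝒳 × Φ)) (ν : Measure 𝒳) : Prop where
  prob : ∀ γ, IsProbabilityMeasure (π γ)
  invariant : ∀ γ, (P.sectL γ).Invariant (π γ)
  marginal : ∀ γ, ∀ B : Set 𝒳, MeasurableSet B → π γ (B ×ˢ Set.univ) = ν B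

end Kernels

/-- Adaptation times `T_m = ∑_{j=1}^m ⌈j ^ β⌉` (so `T_0 = 0`). -/
noncomputable def adaptTime (β : ℝ) (m : ℕ) : ℕ :=
  ∑ j ∈ Finset.Icc 1 m, ⌈(j : ℝ) ^ β⌉₊

section Chain

variable {Ω 𝒴 𝓘 : Type*} [MeasurableSpace 𝒴] [MeasurableSpace 𝓘]

/-- `σ(Y_0, …, Y_n, Γ_0, …, Γ_n)`. -/
@[reducible]
def history (Y : ℕ → Ω → 𝒴) (Γ : ℕ → Ω → 𝓘) (n : ℕ) : MeasurableSpace Ω :=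
  ⨆ i ∈ Finset.range (n + 1),
    (MeasurableSpace.comap (Y i) inferInstance ⊔ MeasurableSpace.comap (Γ i) inferInstance)

/-- An adaptive increasingly rare chain with parameter `β`: states `Y n`, adaptation parameters
`Γ n`, deterministic start, transitions `P_{Γ_n}(Y_n, ·)` given the whole history, measurable
update rules, and adaptation only at the times `T_j`. -/
structure IsAIRChain [MeasurableSpace Ω] (μ : Measure Ω) (P : Kernel (𝒴 × 𝓘) 𝒴) (β : ℝ)
    (Y : ℕ → Ω → 𝒴) (Γ : ℕ → Ω → 𝓘) : Prop where
  measurable_state : ∀ n, Measurable (Y n)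
  measurable_param : ∀ n, Measurable (Γ n)
  initial : ∃ (y₀ : 𝒴) (γ₀ : 𝓘), ∀ᵐ ω ∂μ, Y 0 ω = y₀ ∧ Γ 0 ω = γ₀
  transition : ∀ n, ∀ B : Set 𝒴, MeasurableSet B →
    μ⟦Y (n + 1) ⁻¹' B | history Y Γ n⟧ =ᵐ[μ] fun ω => (P (Y n ω, Γ n ω) B).toReal
  update : ∀ n, ∃ U : (Fin (n + 1) → 𝒴) × (Fin n → 𝓘) → 𝓘, Measurable U ∧
    ∀ᵐ ω ∂μ, Γ n ω = U (fun i => Y i ω, fun i => Γ i ω)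
  rare : ∀ j, ∀ i₁ ∈ Set.Ico (adaptTime β j) (adaptTime β (j + 1)),
    ∀ i₂ ∈ Set.Ico (adaptTime β j) (adaptTime β (j + 1)), ∀ᵐ ω ∂μ, Γ i₁ ω = Γ i₂ ω

end Chain

end AIRMCMC

/-!
The proof solves, for every parameter `γ`, the Poisson equation `g - P_γ g = f - ν(f)` with a bound
`|g| ≤ K √V` uniform in `γ`, and then splits the ergodic sum of the adaptive chain into a martingale,
errors committed at the adaptation times, and a boundary term. Since `V ≥ 1` and `p > 2`, the bound
on `f` is only used in the form `|f| ≤ √V`.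

*Poisson equation.* The function `W = √V` inherits a drift inequality from `V`
(`geomDrift_sqrt`). With `R = P_γ - δ 1_C ⊗ η_γ`, which is a positive operator by the minorisation,
`U = (W + b / δ) / (1 - λ)` satisfies `W + R U ≤ U` (`GeomDrift.add_residual_lyapunov_le`), so that
the potential `g = ∑ Rⁿ (f - ν(f))` converges and is bounded by a multiple of `W`. It solves
`g - P_γ g = f - ν(f) - δ η_γ(g) 1_C`. Integration against the invariant measure `π_γ`, which charges
`C` by `lintegral_invariant_le`, gives `η_γ(g) = 0`, so `g` solves the Poisson equation
(`GeomDrift.exists_poisson`). Neither aperiodicity nor convergence of `P_γⁿ` is involved.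

*Measurability in the parameter.* The measures `η_γ` need not depend measurably on `γ`, so neither
need these potentials. However, `g - π_γ(g)` is the Cesàro limit of the partial sums of
`∑ P_γⁿ (f - ν(f))`, as one sees from the Poisson equation for `g` itself, and this limit is
jointly measurable in the state and in `γ` (`exists_poisson_family`).

*Decomposition.* Let `G_γ` be these solutions. Then `f(X_j) - ν(f)` is the martingale increment
`G_{Γ_j}(Y_{j+1}) - P_{Γ_j} G_{Γ_j}(Y_j)`, plus the error `G_{Γ_{j+1}}(Y_{j+1}) - G_{Γ_j}(Y_{j+1})`,
plus a telescoping term (`sum_sub_eq`). With `s = 1 / 2 + ε`, the increments divided by `j ^ s` form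
an `L²`-bounded martingale, because `E V(Y_j)` is bounded. The errors vanish unless `j + 1` is an
adaptation time; since `T_m ≥ m ^ (1 + β) / (1 + β)` and `(1 + β) s > 1`, they are
absolutely summable after division by `j ^ s`. Kronecker's lemma (`tendsto_sum_div_of_tendsto_sum`)
finishes these two parts, and the boundary term is `o(n ^ s)` because its second moments are bounded.
-/

namespace AIRMCMC

/-! ### The Poisson equation under geometric drift and minorisation -/

section Poisson

variable {𝒴 : Type*} [MeasurableSpace 𝒴]

/-- Geometric drift towards a set `C` on which the kernel `P` dominates `δ • η`, expressed through
real-valued Bochner integrals. -/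
structure GeomDrift (P : Kernel 𝒴 𝒴) (W : 𝒴 → ℝ) (C : Set 𝒴) (η : Measure 𝒴) (lam b δ : ℝ) :
    Prop where
  measurable : Measurable W
  one_le : ∀ y, 1 ≤ W y
  measurableSet : MeasurableSet C
  lam_nonneg : 0 ≤ lam
  lam_lt_one : lam < 1
  b_nonneg : 0 ≤ b
  δ_pos : 0 < δ
  prob : IsProbabilityMeasure η
  integrable : ∀ y, Integrable W (P y)
  drift : ∀ y, ∫ z, W z ∂P y ≤ lam * W y + C.indicator (fun _ => b) y
  minor : ∀ y ∈ C, ENNReal.ofReal δ • η ≤ P y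

/-- The residual operator `P - δ 1_C ⊗ η`, acting on real functions. -/
noncomputable def residual (P : Kernel 𝒴 𝒴) (C : Set 𝒴) (η : Measure 𝒴) (δ : ℝ) (h : 𝒴 → ℝ) :
    𝒴 → ℝ :=
  fun y => ∫ z, h z ∂P y - C.indicator (fun _ => δ * ∫ z, h z ∂η) y

/-- The factor by which the potential of the residual operator enlarges the drift function. -/
noncomputable def potentialConst (lam b δ : ℝ) : ℝ := (1 + b / δ) / (1 - lam)

variable {P : Kernel 𝒴 𝒴} {W : 𝒴 → ℝ} {C : Set 𝒴} {η : Measure 𝒴} {lam b δ : ℝ}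

theorem residual_of_mem {y : 𝒴} (hy : y ∈ C) (h : 𝒴 → ℝ) :
    residual P C η δ h y = ∫ z, h z ∂P y - δ * ∫ z, h z ∂η := by
  simp [residual, hy]

theorem residual_of_notMem {y : 𝒴} (hy : y ∉ C) (h : 𝒴 → ℝ) :
    residual P C η δ h y = ∫ z, h z ∂P y := by
  simp [residual, hy]

namespace GeomDrift

variable (D : GeomDrift P W C η lam b δ)
include D

theorem potentialConst_nonneg : 0 ≤ potentialConst lam b δ := by
  have := D.lam_lt_one
  have := D.b_nonneg
  have := D.δ_pos
  have : 0 < 1 - lam := by linarith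
  unfold potentialConst
  positivity

theorem integrable_of_abs_le {h : 𝒴 → ℝ} (hm : Measurable h) {c : ℝ} (hc : ∀ y, |h y| ≤ c * W y)
    (y : 𝒴) : Integrable h (P y) :=
  ((D.integrable y).const_mul c).mono' hm.aestronglyMeasurable (.of_forall hc)

theorem integrable_minor {h : 𝒴 → ℝ} {y : 𝒴} (hy : y ∈ C) (hh : Integrable h (P y)) :
    Integrable h η := by
  have := hh.mono_measure (D.minor y hy)
  rwa [integrable_smul_measure (by simpa using D.δ_pos) ENNReal.ofReal_ne_top] at this

theorem measurable_residual {h : 𝒴 → ℝ} (hm : Measurable h) :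
    Measurable (residual P C η δ h) :=
  hm.stronglyMeasurable.integral_kernel.measurable.sub (measurable_const.indicator D.measurableSet)

theorem residual_add {g h : 𝒴 → ℝ} (hg : ∀ y, Integrable g (P y)) (hh : ∀ y, Integrable h (P y))
    (y : 𝒴) : residual P C η δ (fun z => g z + h z) y
      = residual P C η δ g y + residual P C η δ h y := by
  by_cases hy : y ∈ C
  · simp only [residual_of_mem hy]
    rw [integral_add (hg y) (hh y),
      integral_add (D.integrable_minor hy (hg y)) (D.integrable_minor hy (hh y))]
    ring
  · simp only [residual_of_notMem hy]
    exact integral_add (hg y) (hh y)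

omit D in
theorem residual_const_mul (c : ℝ) (h : 𝒴 → ℝ) (y : 𝒴) :
    residual P C η δ (fun z => c * h z) y = c * residual P C η δ h y := by
  by_cases hy : y ∈ C
  · simp only [residual_of_mem hy, integral_const_mul]
    ring
  · simp only [residual_of_notMem hy, integral_const_mul]

/-- The residual operator is positive, because `P` dominates `δ • η` on `C`. -/
theorem residual_mono {g h : 𝒴 → ℝ} (hg : ∀ y, Integrable g (P y)) (hh : ∀ y, Integrable h (P y))
    (hgh : ∀ y, g y ≤ h y) (y : 𝒴) : residual P C η δ g y ≤ residual P C η δ h y := by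
  by_cases hy : y ∈ C
  · have hi : Integrable (fun z => h z - g z) (P y) := (hh y).sub (hg y)
    have key := integral_mono_measure (D.minor y hy)
      (.of_forall fun z => sub_nonneg.2 (hgh z)) hi
    rw [integral_smul_measure, ENNReal.toReal_ofReal D.δ_pos.le, smul_eq_mul,
      integral_sub (hh y) (hg y),
      integral_sub (D.integrable_minor hy (hh y)) (D.integrable_minor hy (hg y))] at key
    simp only [residual_of_mem hy]
    linarith
  · simp only [residual_of_notMem hy]
    exact integral_mono (hg y) (hh y) hgh

variable [IsMarkovKernel P]

/-- `(W + b / δ) / (1 - lam)` is a Lyapunov function for the residual operator: adding the constant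
`b / δ` absorbs the excess `b` of the drift on `C`, since the residual operator has lost mass `δ`
there. -/
theorem add_residual_lyapunov_le (y : 𝒴) :
    W y + residual P C η δ (fun z => (W z + b / δ) / (1 - lam)) y
      ≤ (W y + b / δ) / (1 - lam) := by
  have h1 : 0 < 1 - lam := sub_pos.2 D.lam_lt_one
  have hδ := D.δ_pos
  have := D.prob
  have hP : ∫ z, (W z + b / δ) / (1 - lam) ∂P y = (∫ z, W z ∂P y + b / δ) / (1 - lam) := by
    rw [integral_div, integral_add (D.integrable y) (integrable_const _)]
    simp
  have hd := D.drift y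
  by_cases hy : y ∈ C
  · rw [residual_of_mem hy, hP]
    have hη : ∫ z, (W z + b / δ) / (1 - lam) ∂η = (∫ z, W z ∂η + b / δ) / (1 - lam) := by
      rw [integral_div, integral_add (D.integrable_minor hy (D.integrable y)) (integrable_const _)]
      simp
    have hη0 : 0 ≤ ∫ z, W z ∂η := integral_nonneg fun z => zero_le_one.trans (D.one_le z)
    rw [hη]
    simp only [Set.indicator_of_mem hy] at hd
    have e : W y + ((∫ z, W z ∂P y + b / δ) / (1 - lam)
        - δ * ((∫ z, W z ∂η + b / δ) / (1 - lam)))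
        = ((1 - lam) * W y + ∫ z, W z ∂P y + b / δ - δ * ∫ z, W z ∂η - b) / (1 - lam) := by
      field_simp
      ring
    rw [e]
    gcongr
    have : 0 ≤ δ * ∫ z, W z ∂η := by positivity
    linarith
  · rw [residual_of_notMem hy, hP]
    simp only [Set.indicator_of_notMem hy] at hd
    have e : W y + (∫ z, W z ∂P y + b / δ) / (1 - lam)
        = ((1 - lam) * W y + ∫ z, W z ∂P y + b / δ) / (1 - lam) := by
      field_simp
      ring
    rw [e]
    gcongr
    linarith

/-- The potential `∑ₙ Rⁿ h` of a nonnegative function, `R` being the residual operator. -/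
theorem exists_potential_of_nonneg {h : 𝒴 → ℝ} (hm : Measurable h) (h0 : ∀ y, 0 ≤ h y) {c : ℝ}
    (hc0 : 0 ≤ c) (hc : ∀ y, h y ≤ c * W y) :
    ∃ g : 𝒴 → ℝ, Measurable g ∧ (∀ y, 0 ≤ g y) ∧ (∀ y, g y ≤ c * potentialConst lam b δ * W y) ∧
      ∀ y, g y = h y + residual P C η δ g y := by
  have h1 : 0 < 1 - lam := sub_pos.2 D.lam_lt_one
  have hδ := D.δ_pos
  have hb := D.b_nonneg
  set K := potentialConst lam b δ with hK
  set U : 𝒴 → ℝ := fun z => (W z + b / δ) / (1 - lam) with hU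
  have hUK : ∀ y, U y ≤ K * W y := fun y => by
    have hW := D.one_le y
    have hbd : 0 ≤ b / δ := by positivity
    simp only [hU, hK, potentialConst]
    rw [div_mul_eq_mul_div]
    gcongr
    nlinarith
  have hU0 : ∀ y, 0 ≤ U y := fun y => by
    have hW := D.one_le y
    simp only [hU]
    positivity
  have hUm : Measurable U := (D.measurable.add_const _).div_const _
  let s : ℕ → 𝒴 → ℝ := fun n => Nat.rec (fun _ => 0) (fun _ g y => h y + residual P C η δ g y) n
  have hs1 : ∀ n y, s (n + 1) y = h y + residual P C η δ (s n) y := fun _ _ => rfl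
  have hsm : ∀ n, Measurable (s n) := by
    intro n
    induction n with
    | zero => exact measurable_const
    | succ n ih => exact hm.add (D.measurable_residual ih)
  have hcUi : ∀ y, Integrable (fun z => c * U z) (P y) := fun y =>
    (D.integrable_of_abs_le hUm (fun z => by rw [abs_of_nonneg (hU0 z)]; exact hUK z) y).const_mul c
  have hsb : ∀ n, ∀ y, 0 ≤ s n y ∧ s n y ≤ c * U y := by
    intro n
    induction n with
    | zero => exact fun y => ⟨le_rfl, mul_nonneg hc0 (hU0 y)⟩
    | succ n ih =>
      have hi : ∀ y, Integrable (s n) (P y) := fun y =>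
        (hcUi y).mono' (hsm n).aestronglyMeasurable
          (.of_forall fun z => by rw [Real.norm_eq_abs, abs_of_nonneg (ih z).1]; exact (ih z).2)
      intro y
      rw [hs1]
      constructor
      · have := D.residual_mono (fun y => integrable_zero 𝒴 ℝ (P y)) hi (fun z => (ih z).1) y
        have e : residual P C η δ (fun _ => (0 : ℝ)) y = 0 := by simp [residual]
        have e2 := e ▸ this
        exact add_nonneg (h0 y) e2
      · have h2 := D.residual_mono hi hcUi (fun z => (ih z).2) y
        rw [residual_const_mul] at h2
        have h3 := mul_le_mul_of_nonneg_left (D.add_residual_lyapunov_le y) hc0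
        have h4 := hc y
        rw [mul_add] at h3
        linarith
  have hsi : ∀ n y, Integrable (s n) (P y) := fun n y =>
    (hcUi y).mono' (hsm n).aestronglyMeasurable
      (.of_forall fun z => by rw [Real.norm_eq_abs, abs_of_nonneg (hsb n z).1]; exact (hsb n z).2)
  have hmono : ∀ n y, s n y ≤ s (n + 1) y := by
    intro n
    induction n with
    | zero => exact fun y => (hsb 1 y).1
    | succ n ih =>
      intro y
      rw [hs1 n, hs1 (n + 1)]
      exact add_le_add le_rfl (D.residual_mono (hsi n) (hsi (n + 1)) ih y)
  have hlim : ∀ y, Tendsto (fun n => s n y) atTop (𝓝 (⨆ n, s n y)) := fun y =>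
    tendsto_atTop_ciSup (monotone_nat_of_le_succ fun n => hmono n y)
      ⟨c * U y, by rintro _ ⟨n, rfl⟩; exact (hsb n y).2⟩
  set g : 𝒴 → ℝ := fun y => ⨆ n, s n y with hg
  have hgm : Measurable g := measurable_of_tendsto_metrizable hsm (tendsto_pi_nhds.2 hlim)
  have hintlim : ∀ ρ : Measure 𝒴, Integrable (fun z => c * U z) ρ →
      Tendsto (fun n => ∫ z, s n z ∂ρ) atTop (𝓝 (∫ z, g z ∂ρ)) := fun ρ hρ =>
    tendsto_integral_of_dominated_convergence _ (fun n => (hsm n).aestronglyMeasurable) hρ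
      (fun n => .of_forall fun z => by
        rw [Real.norm_eq_abs, abs_of_nonneg (hsb n z).1]; exact (hsb n z).2)
      (.of_forall hlim)
  refine ⟨g, hgm, fun y => ge_of_tendsto' (hlim y) fun n => (hsb n y).1, fun y => ?_, fun y => ?_⟩
  · refine (le_of_tendsto' (hlim y) fun n => (hsb n y).2).trans ?_
    rw [mul_assoc]
    exact mul_le_mul_of_nonneg_left (hUK y) hc0
  · refine tendsto_nhds_unique ((tendsto_add_atTop_iff_nat 1).2 (hlim y)) ?_
    simp only [hs1]
    refine tendsto_const_nhds.add ?_
    by_cases hy : y ∈ C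
    · simp only [residual_of_mem hy]
      exact (hintlim _ (hcUi y)).sub
        ((hintlim _ (D.integrable_minor hy (hcUi y))).const_mul δ)
    · simp only [residual_of_notMem hy]
      exact hintlim _ (hcUi y)

theorem exists_potential {h : 𝒴 → ℝ} (hm : Measurable h) {c : ℝ} (hc0 : 0 ≤ c)
    (hc : ∀ y, |h y| ≤ c * W y) :
    ∃ g : 𝒴 → ℝ, Measurable g ∧ (∀ y, |g y| ≤ 2 * c * potentialConst lam b δ * W y) ∧
      ∀ y, g y = h y + residual P C η δ g y := by
  have hK := D.potentialConst_nonneg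
  obtain ⟨g₁, m₁, p₁, b₁, e₁⟩ := D.exists_potential_of_nonneg (h := fun y => h y + c * W y)
    (c := 2 * c) (hm.add (D.measurable.const_mul c))
    (fun y => by linarith [neg_abs_le (h y), hc y]) (by positivity)
    (fun y => by linarith [le_abs_self (h y), hc y])
  obtain ⟨g₂, m₂, p₂, b₂, e₂⟩ := D.exists_potential_of_nonneg (h := fun y => c * W y)
    (c := c) (D.measurable.const_mul c)
    (fun y => mul_nonneg hc0 (zero_le_one.trans (D.one_le y))) hc0 (fun y => le_rfl)
  have i₁ : ∀ y, Integrable g₁ (P y) := D.integrable_of_abs_le m₁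
    (fun y => by rw [abs_of_nonneg (p₁ y)]; exact b₁ y)
  have i₂ : ∀ y, Integrable g₂ (P y) := D.integrable_of_abs_le m₂
    (fun y => by rw [abs_of_nonneg (p₂ y)]; exact b₂ y)
  refine ⟨fun y => g₁ y + (-1) * g₂ y, m₁.add (m₂.const_mul _), fun y => ?_, fun y => ?_⟩
  · have hW := D.one_le y
    have : c * potentialConst lam b δ * W y ≤ 2 * c * potentialConst lam b δ * W y := by
      have : 0 ≤ c * potentialConst lam b δ * W y := by positivity
      linarith
    rw [abs_le]
    constructor <;> linarith [p₁ y, p₂ y, b₁ y, b₂ y]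
  · rw [D.residual_add i₁ (fun y => (i₂ y).const_mul _), residual_const_mul]
    linarith [e₁ y, e₂ y]

end GeomDrift

theorem _root_.ProbabilityTheory.Kernel.Invariant.integral_integral [IsMarkovKernel P]
    {π : Measure 𝒴} [IsProbabilityMeasure π] (hinv : P.Invariant π) {g : 𝒴 → ℝ}
    (hg : Integrable g π) :
    Integrable (fun y => ∫ z, g z ∂P y) π ∧ ∫ y, ∫ z, g z ∂P y ∂π = ∫ y, g y ∂π := by
  have hsnd : (π ⊗ₘ P).map Prod.snd = π := by
    have := Measure.snd_compProd π P
    rw [Measure.snd] at this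
    rw [this, hinv.def]
  have hi : Integrable (fun q : 𝒴 × 𝒴 => g q.2) (π ⊗ₘ P) := by
    rw [← hsnd] at hg
    exact hg.comp_measurable measurable_snd
  refine ⟨by simpa using MeasureTheory.Integrable.integral_compProd hi, ?_⟩
  rw [← Measure.integral_compProd hi]
  conv_rhs => rw [← hsnd]
  rw [integral_map measurable_snd.aemeasurable (by rw [hsnd]; exact hg.aestronglyMeasurable)]

/-- A kernel acting repeatedly on a function: `kernelIter P h n y` is the integral of `h` against
the `n`-step law of `P` started at `y`. -/
noncomputable def kernelIter (P : Kernel 𝒴 𝒴) (h : 𝒴 → ℝ) : ℕ → 𝒴 → ℝ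
  | 0 => h
  | n + 1 => fun y => ∫ z, kernelIter P h n z ∂P y

theorem measurable_kernelIter {h : 𝒴 → ℝ} (hm : Measurable h) (n : ℕ) :
    Measurable (kernelIter P h n) := by
  induction n with
  | zero => exact hm
  | succ n ih => exact ih.stronglyMeasurable.integral_kernel.measurable

/-- A factor `K`, depending on the constants of drift and minorisation only, such that the Poisson
equation for a function bounded by `W` has a solution bounded by `K * W`. -/
noncomputable def poissonConst (lam b δ : ℝ) : ℝ :=
  2 * (1 + b / (1 - lam)) * potentialConst lam b δ

namespace GeomDrift

variable (D : GeomDrift P W C η lam b δ)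
include D

theorem div_one_sub_nonneg : 0 ≤ b / (1 - lam) :=
  div_nonneg D.b_nonneg (sub_pos.2 D.lam_lt_one).le

theorem poissonConst_nonneg : 0 ≤ poissonConst lam b δ := by
  have h1 := D.div_one_sub_nonneg
  have h2 := D.potentialConst_nonneg
  unfold poissonConst
  positivity

theorem drift_le (y : 𝒴) : ∫ z, W z ∂P y ≤ lam * W y + b := by
  refine (D.drift y).trans (add_le_add le_rfl ?_)
  exact Set.indicator_le_self' (fun _ _ => D.b_nonneg) y

variable [IsMarkovKernel P]

theorem integral_le {π : Measure 𝒴} [IsProbabilityMeasure π] (hinv : P.Invariant π)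
    (hW : Integrable W π) : ∫ y, W y ∂π ≤ b / (1 - lam) := by
  obtain ⟨hi, he⟩ := hinv.integral_integral hW
  have h1 : ∫ y, ∫ z, W z ∂P y ∂π ≤ ∫ y, (lam * W y + b) ∂π :=
    integral_mono hi ((hW.const_mul _).add (integrable_const _)) D.drift_le
  rw [he, integral_add (hW.const_mul _) (integrable_const _), integral_const_mul] at h1
  simp only [integral_const, probReal_univ, smul_eq_mul, one_mul] at h1
  rw [le_div_iff₀ (sub_pos.2 D.lam_lt_one)]
  linarith

/-- Integrating `g = h + R g` against `π` shows that the potential `g` of a centred `h` is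
`η`-centred, so that the residual operator and `P` agree on it. -/
theorem exists_poisson_of_centred {π : Measure 𝒴} [IsProbabilityMeasure π] (hinv : P.Invariant π)
    (hW : Integrable W π) (hC : π C ≠ 0) {h : 𝒴 → ℝ} (hm : Measurable h) {c : ℝ} (hc0 : 0 ≤ c)
    (hc : ∀ y, |h y| ≤ c * W y) (h0 : ∫ y, h y ∂π = 0) :
    ∃ g : 𝒴 → ℝ, Measurable g ∧ (∀ y, |g y| ≤ 2 * c * potentialConst lam b δ * W y) ∧
      ∀ y, g y - ∫ z, g z ∂P y = h y := by
  obtain ⟨g, gm, gb, ge⟩ := D.exists_potential hm hc0 hc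
  refine ⟨g, gm, gb, ?_⟩
  have hgi : Integrable g π := (hW.const_mul _).mono' gm.aestronglyMeasurable (.of_forall gb)
  have hhi : Integrable h π := (hW.const_mul _).mono' hm.aestronglyMeasurable (.of_forall hc)
  obtain ⟨hPi, hPe⟩ := hinv.integral_integral hgi
  have key : ∫ y, C.indicator (fun _ => δ * ∫ z, g z ∂η) y ∂π = 0 := by
    have e : ∀ y, C.indicator (fun _ => δ * ∫ z, g z ∂η) y = h y + ∫ z, g z ∂P y - g y := by
      intro y
      have := ge y
      unfold residual at this
      linarith
    have hs : Integrable (fun y => h y + ∫ z, g z ∂P y) π := hhi.add hPi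
    rw [integral_congr_ae (.of_forall e), integral_sub hs hgi, integral_add hhi hPi, h0, hPe]
    ring
  rw [integral_indicator_const _ D.measurableSet, smul_eq_mul] at key
  have hC' : π.real C ≠ 0 := by
    rw [measureReal_def]
    exact ENNReal.toReal_ne_zero.2 ⟨hC, measure_ne_top _ _⟩
  have hη : δ * ∫ z, g z ∂η = 0 := (mul_eq_zero.1 key).resolve_left hC'
  intro y
  have := ge y
  simp only [residual, hη] at this
  simp only [Set.indicator_zero] at this
  linarith

theorem abs_sub_integral_le {π : Measure 𝒴} [IsProbabilityMeasure π] (hinv : P.Invariant π)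
    (hW : Integrable W π) {h : 𝒴 → ℝ} {c : ℝ} (hc0 : 0 ≤ c) (hc : ∀ y, |h y| ≤ c * W y) (y : 𝒴) :
    |h y - ∫ z, h z ∂π| ≤ c * (1 + b / (1 - lam)) * W y := by
  have h1 : |∫ z, h z ∂π| ≤ c * (b / (1 - lam)) := by
    calc |∫ z, h z ∂π| ≤ ∫ z, c * W z ∂π := by
          rw [← Real.norm_eq_abs]
          exact norm_integral_le_of_norm_le (hW.const_mul c) (.of_forall hc)
      _ ≤ _ := by
          rw [integral_const_mul]
          exact mul_le_mul_of_nonneg_left (D.integral_le hinv hW) hc0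
  have h2 : c * (b / (1 - lam)) ≤ c * (b / (1 - lam)) * W y :=
    le_mul_of_one_le_right (mul_nonneg hc0 D.div_one_sub_nonneg) (D.one_le y)
  calc |h y - ∫ z, h z ∂π| ≤ |h y| + |∫ z, h z ∂π| := abs_sub _ _
    _ ≤ c * W y + c * (b / (1 - lam)) * W y := add_le_add (hc y) (h1.trans h2)
    _ = _ := by ring

theorem exists_poisson {π : Measure 𝒴} [IsProbabilityMeasure π] (hinv : P.Invariant π)
    (hW : Integrable W π) (hC : π C ≠ 0) {h : 𝒴 → ℝ} (hm : Measurable h) {c : ℝ} (hc0 : 0 ≤ c)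
    (hc : ∀ y, |h y| ≤ c * W y) :
    ∃ g : 𝒴 → ℝ, Measurable g ∧ (∀ y, |g y| ≤ c * poissonConst lam b δ * W y) ∧
      ∀ y, g y - ∫ z, g z ∂P y = h y - ∫ z, h z ∂π := by
  have hhi : Integrable h π := (hW.const_mul _).mono' hm.aestronglyMeasurable (.of_forall hc)
  obtain ⟨g, gm, gb, ge⟩ := D.exists_poisson_of_centred hinv hW hC (hm.sub_const (∫ z, h z ∂π))
    (mul_nonneg hc0 (add_nonneg zero_le_one D.div_one_sub_nonneg))
    (D.abs_sub_integral_le hinv hW hc0 hc) (by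
      rw [integral_sub hhi (integrable_const _)]
      simp)
  refine ⟨g, gm, fun y => (gb y).trans (le_of_eq ?_), ge⟩
  unfold poissonConst
  ring

/-- Iterating the drift inequality: `Pⁿ W ≤ lamⁿ (W - B) + B` with `B = b / (1 - lam)`. -/
theorem abs_kernelIter_le {h : 𝒴 → ℝ} {c : ℝ} (hc0 : 0 ≤ c)
    (hc : ∀ y, |h y| ≤ c * W y) (n : ℕ) (y : 𝒴) :
    |kernelIter P h n y| ≤ c * (lam ^ n * (W y - b / (1 - lam)) + b / (1 - lam)) := by
  have h1 : 1 - lam ≠ 0 := (sub_pos.2 D.lam_lt_one).ne'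
  induction n generalizing y with
  | zero => simpa [kernelIter] using hc y
  | succ n ih =>
    have hi' : Integrable (fun z => lam ^ n * (W z - b / (1 - lam))) (P y) :=
      ((D.integrable y).sub (integrable_const _)).const_mul _
    have hi : Integrable
        (fun z => c * (lam ^ n * (W z - b / (1 - lam)) + b / (1 - lam))) (P y) :=
      (hi'.add (integrable_const _)).const_mul _
    have hb : |∫ z, kernelIter P h n z ∂P y|
        ≤ ∫ z, c * (lam ^ n * (W z - b / (1 - lam)) + b / (1 - lam)) ∂P y := by
      rw [← Real.norm_eq_abs]
      exact norm_integral_le_of_norm_le hi (.of_forall ih)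
    refine hb.trans ?_
    rw [integral_const_mul, integral_add hi' (integrable_const _),
      integral_const_mul, integral_sub (D.integrable y) (integrable_const _)]
    simp only [integral_const, probReal_univ, smul_eq_mul, one_mul]
    refine mul_le_mul_of_nonneg_left (add_le_add ?_ le_rfl) hc0
    rw [pow_succ, mul_assoc]
    refine mul_le_mul_of_nonneg_left ?_ (pow_nonneg D.lam_nonneg n)
    have e : lam * W y + b - b / (1 - lam) = lam * (W y - b / (1 - lam)) := by
      field_simp
      ring
    rw [← e]
    exact sub_le_sub_right (D.drift_le y) _

theorem abs_kernelIter_le' {h : 𝒴 → ℝ} {c : ℝ} (hc0 : 0 ≤ c)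
    (hc : ∀ y, |h y| ≤ c * W y) (n : ℕ) (y : 𝒴) :
    |kernelIter P h n y| ≤ c * (1 + b / (1 - lam)) * W y := by
  refine (D.abs_kernelIter_le hc0 hc n y).trans ?_
  rw [mul_assoc]
  refine mul_le_mul_of_nonneg_left ?_ hc0
  have hB := D.div_one_sub_nonneg
  have hW := D.one_le y
  have hl0 := pow_nonneg D.lam_nonneg n
  have hl1 : lam ^ n ≤ 1 := pow_le_one₀ D.lam_nonneg D.lam_lt_one.le
  nlinarith [mul_le_mul_of_nonneg_right hl1 (zero_le_one.trans hW), mul_nonneg hl0 hB,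
    mul_le_mul_of_nonneg_left hW hB]

theorem integrable_kernelIter {h : 𝒴 → ℝ} (hm : Measurable h) {c : ℝ} (hc0 : 0 ≤ c)
    (hc : ∀ y, |h y| ≤ c * W y) (n : ℕ) (y : 𝒴) : Integrable (kernelIter P h n) (P y) :=
  D.integrable_of_abs_le (measurable_kernelIter hm n) (D.abs_kernelIter_le' hc0 hc n) y

/-- The partial sums of `∑ₙ Pⁿ (h - π h)` telescope along a solution of the Poisson equation. -/
theorem kernelIter_eq_sub {g h : 𝒴 → ℝ} {a c : ℝ} (hg : Measurable g)
    (hc0 : 0 ≤ c) (hc : ∀ y, |g y| ≤ c * W y) (he : ∀ y, g y - ∫ z, g z ∂P y = h y - a)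
    (n : ℕ) (y : 𝒴) :
    kernelIter P (fun z => h z - a) n y = kernelIter P g n y - kernelIter P g (n + 1) y := by
  induction n generalizing y with
  | zero => exact (he y).symm
  | succ n ih =>
    change ∫ z, kernelIter P (fun z => h z - a) n z ∂P y = _
    rw [integral_congr_ae (.of_forall ih), integral_sub (D.integrable_kernelIter hg hc0 hc n y)
      (D.integrable_kernelIter hg hc0 hc (n + 1) y)]
    rfl

omit D in
theorem kernelIter_sub_const {h : 𝒴 → ℝ} (a : ℝ) {n : ℕ} (hi : ∀ k y, Integrable
    (kernelIter P h k) (P y)) (y : 𝒴) :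
    kernelIter P (fun z => h z - a) n y = kernelIter P h n y - a := by
  induction n generalizing y with
  | zero => rfl
  | succ n ih =>
    change ∫ z, kernelIter P (fun z => h z - a) n z ∂P y = _
    rw [integral_congr_ae (.of_forall ih), integral_sub (hi n y) (integrable_const _)]
    simp [kernelIter]

/-- The mean ergodic theorem, pointwise. -/
theorem tendsto_average_kernelIter {π : Measure 𝒴} [IsProbabilityMeasure π]
    (hinv : P.Invariant π) (hW : Integrable W π) (hC : π C ≠ 0) {h : 𝒴 → ℝ} (hm : Measurable h)
    {c : ℝ} (hc0 : 0 ≤ c) (hc : ∀ y, |h y| ≤ c * W y) (y : 𝒴) :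
    Tendsto (fun N : ℕ => (N : ℝ)⁻¹ * ∑ n ∈ Finset.range N, kernelIter P h n y) atTop
      (𝓝 (∫ z, h z ∂π)) := by
  obtain ⟨g, gm, gb, ge⟩ := D.exists_poisson hinv hW hC hm hc0 hc
  have hcK : 0 ≤ c * poissonConst lam b δ := mul_nonneg hc0 D.poissonConst_nonneg
  set a := ∫ z, h z ∂π
  have e : ∀ n, kernelIter P h n y = a + (kernelIter P g n y - kernelIter P g (n + 1) y) := by
    intro n
    rw [← D.kernelIter_eq_sub gm hcK gb ge,
      kernelIter_sub_const a (D.integrable_kernelIter hm hc0 hc)]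
    ring
  have hsum : ∀ N : ℕ, ∑ n ∈ Finset.range N, kernelIter P h n y
      = N * a + (g y - kernelIter P g N y) := by
    intro N
    simp only [e, Finset.sum_add_distrib, Finset.sum_const, Finset.card_range, nsmul_eq_mul]
    rw [Finset.sum_range_sub' (fun n => kernelIter P g n y) N]
    rfl
  have hbd : Tendsto (fun N : ℕ => (N : ℝ)⁻¹ * (g y - kernelIter P g N y)) atTop (𝓝 0) := by
    refine tendsto_inv_atTop_nhds_zero_nat.zero_mul_isBoundedUnder_le ?_
    refine isBoundedUnder_of
      ⟨|g y| + c * poissonConst lam b δ * (1 + b / (1 - lam)) * W y, fun N => ?_⟩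
    exact (abs_sub _ _).trans (add_le_add le_rfl (D.abs_kernelIter_le' hcK gb N y))
  have hlim := hbd.const_add a
  rw [add_zero] at hlim
  refine hlim.congr' ?_
  filter_upwards [eventually_gt_atTop 0] with N hN
  have : (N : ℝ) ≠ 0 := by positivity
  rw [hsum]
  field_simp

/-- A solution of the Poisson equation that is the limit of the Cesàro means of
`∑_{n < k} Pⁿ (h - π h)`. This description involves only `P`, and thus carries over measurability in
a parameter on which `P` depends, although the minorising measure need not depend measurably
on it. -/
theorem exists_poisson_tendsto {π : Measure 𝒴} [IsProbabilityMeasure π] (hinv : P.Invariant π)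
    (hW : Integrable W π) (hC : π C ≠ 0) {h : 𝒴 → ℝ} (hm : Measurable h)
    (hc : ∀ y, |h y| ≤ W y) :
    ∃ g : 𝒴 → ℝ, Measurable g ∧
      (∀ y, |g y| ≤ poissonConst lam b δ * (1 + b / (1 - lam)) * W y) ∧
      (∀ y, g y - ∫ z, g z ∂P y = h y - ∫ z, h z ∂π) ∧
      ∀ y, Tendsto (fun N : ℕ => (N : ℝ)⁻¹ * ∑ k ∈ Finset.range N, ∑ n ∈ Finset.range k,
        kernelIter P (fun z => h z - ∫ w, h w ∂π) n y) atTop (𝓝 (g y)) := by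
  obtain ⟨g, gm, gb, ge⟩ := D.exists_poisson hinv hW hC hm zero_le_one
    (fun y => (hc y).trans (one_mul _).ge)
  rw [one_mul] at gb
  have hK := D.poissonConst_nonneg
  refine ⟨fun y => g y - ∫ z, g z ∂π, gm.sub_const _, D.abs_sub_integral_le hinv hW hK gb,
    fun y => ?_, fun y => ?_⟩
  · rw [← ge y, integral_sub (D.integrable_of_abs_le gm gb y) (integrable_const _)]
    simp
  · refine ((D.tendsto_average_kernelIter hinv hW hC gm hK gb y).const_sub (g y)).congr' ?_
    filter_upwards [eventually_gt_atTop 0] with N hN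
    have hN' : (N : ℝ) ≠ 0 := by positivity
    have e : ∀ k, ∑ n ∈ Finset.range k, kernelIter P (fun z => h z - ∫ w, h w ∂π) n y
        = g y - kernelIter P g k y := by
      intro k
      rw [Finset.sum_congr rfl fun n _ => D.kernelIter_eq_sub gm hK gb ge n y,
        Finset.sum_range_sub' (fun n => kernelIter P g n y) k]
      rfl
    simp only [e, Finset.sum_sub_distrib, Finset.sum_const, Finset.card_range, nsmul_eq_mul]
    field_simp

end GeomDrift

end Poisson

/-! ### Consequences of simultaneous drift and minorisation -/

section Drift

variable {𝒴 𝓘 : Type*} [MeasurableSpace 𝒴] [MeasurableSpace 𝓘]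

/-- The drift inequality bounds `π V` for invariant `π`. Integrability of `V` is not known in
advance, so invariance is applied to the truncations `min V N`, and Fatou's lemma is applied to
`min V N - min (κ V) N`. -/
theorem lintegral_invariant_le {P : Kernel 𝒴 𝒴} [IsMarkovKernel P] {π : Measure 𝒴}
    [IsProbabilityMeasure π] (hinv : P.Invariant π) {V : 𝒴 → ℝ} (hVm : Measurable V)
    (hV0 : ∀ y, 0 ≤ V y) {C : Set 𝒴} (hC : MeasurableSet C) {κ b : ℝ} (hκ0 : 0 ≤ κ) (hκ1 : κ ≤ 1)
    (hd : ∀ y, ∫⁻ z, ENNReal.ofReal (V z) ∂P y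
      ≤ ENNReal.ofReal (κ * V y + C.indicator (fun _ => b) y)) :
    ∫⁻ y, ENNReal.ofReal ((1 - κ) * V y) ∂π ≤ ENNReal.ofReal b * π C := by
  set v : 𝒴 → ENNReal := fun y => ENNReal.ofReal (V y) with hv
  have hvm : Measurable v := hVm.ennreal_ofReal
  set w : 𝒴 → ENNReal := fun y => ENNReal.ofReal (κ * V y) with hw
  have hwm : Measurable w := (hVm.const_mul κ).ennreal_ofReal
  have hwv : ∀ y, w y ≤ v y := fun y =>
    ENNReal.ofReal_le_ofReal (mul_le_of_le_one_left (hV0 y) hκ1)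
  have hd' : ∀ y, ∫⁻ z, v z ∂P y ≤ w y + C.indicator (fun _ => ENNReal.ofReal b) y := by
    intro y
    refine (hd y).trans (ENNReal.ofReal_add_le.trans (add_le_add le_rfl ?_))
    by_cases hy : y ∈ C <;> simp [hy]
  have hN : ∀ N : ℕ, ∫⁻ y, (min (v y) N - min (w y) N) ∂π ≤ ENNReal.ofReal b * π C := by
    intro N
    have hfin : ∫⁻ y, min (w y) N ∂π ≠ ⊤ := by
      refine ne_top_of_le_ne_top (ENNReal.natCast_ne_top N)
        ((lintegral_mono fun y => min_le_right (w y) (N : ENNReal)).trans ?_)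
      simp
    rw [lintegral_sub (hwm.min measurable_const) hfin
      (.of_forall fun y => min_le_min_right _ (hwv y)), tsub_le_iff_left]
    calc ∫⁻ y, min (v y) N ∂π = ∫⁻ y, ∫⁻ z, min (v z) N ∂P y ∂π := by
          conv_lhs => rw [← hinv.def]
          exact Measure.lintegral_bind P.measurable.aemeasurable
            (hvm.min measurable_const).aemeasurable
      _ ≤ ∫⁻ y, (min (w y) N + C.indicator (fun _ => ENNReal.ofReal b) y) ∂π := by
          refine lintegral_mono fun y => ?_
          have h1 : ∫⁻ z, min (v z) N ∂P y ≤ N :=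
            (lintegral_mono fun z => min_le_right (v z) (N : ENNReal)).trans (by simp)
          have h2 : ∫⁻ z, min (v z) N ∂P y
              ≤ w y + C.indicator (fun _ => ENNReal.ofReal b) y :=
            (lintegral_mono fun z => min_le_left (v z) (N : ENNReal)).trans (hd' y)
          rw [← min_add_add_right]
          exact le_min h2 (h1.trans le_self_add)
      _ = _ := by
          rw [lintegral_add_left (hwm.min measurable_const), lintegral_indicator_const hC]
  have hlim : ∀ y, liminf (fun N : ℕ => min (v y) N - min (w y) N) atTop
      = ENNReal.ofReal ((1 - κ) * V y) := by
    intro y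
    refine Tendsto.liminf_eq (tendsto_const_nhds.congr' ?_)
    obtain ⟨M, hM⟩ := ENNReal.exists_nat_gt (r := v y) ENNReal.ofReal_ne_top
    filter_upwards [eventually_ge_atTop M] with N hMN
    have h1 : v y ≤ N := hM.le.trans (by exact_mod_cast hMN)
    rw [min_eq_left h1, min_eq_left ((hwv y).trans h1), hv, hw]
    simp only
    rw [← ENNReal.ofReal_sub _ (mul_nonneg hκ0 (hV0 y))]
    congr 1
    ring
  calc ∫⁻ y, ENNReal.ofReal ((1 - κ) * V y) ∂π
      = ∫⁻ y, liminf (fun N : ℕ => min (v y) N - min (w y) N) atTop ∂π := by simp_rw [hlim]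
    _ ≤ liminf (fun N : ℕ => ∫⁻ y, (min (v y) N - min (w y) N) ∂π) atTop :=
        lintegral_liminf_le fun N => (hvm.min measurable_const).sub (hwm.min measurable_const)
    _ ≤ ENNReal.ofReal b * π C :=
        liminf_le_of_frequently_le' (Frequently.of_forall hN)

/-- Jensen's inequality for the square root, by the tangent line `√v ≤ (v / t + t) / 2`. -/
theorem integral_sqrt_le {ρ : Measure 𝒴} [IsProbabilityMeasure ρ] {V : 𝒴 → ℝ} (hVm : Measurable V)
    (hV0 : ∀ y, 0 ≤ V y) {a : ℝ} (ha : 0 < a)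
    (h : ∫⁻ y, ENNReal.ofReal (V y) ∂ρ ≤ ENNReal.ofReal a) :
    Integrable (fun y => √(V y)) ρ ∧ ∫ y, √(V y) ∂ρ ≤ √a := by
  have hVi : Integrable V ρ := by
    refine ⟨hVm.aestronglyMeasurable, ?_⟩
    rw [hasFiniteIntegral_iff_ofReal (.of_forall hV0)]
    exact h.trans_lt ENNReal.ofReal_lt_top
  have hVa : ∫ y, V y ∂ρ ≤ a := by
    rw [integral_eq_lintegral_of_nonneg_ae (.of_forall hV0) hVm.aestronglyMeasurable]
    exact ENNReal.toReal_le_of_le_ofReal ha.le h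
  set t := √a with ht
  have ht0 : 0 < t := Real.sqrt_pos.2 ha
  have hta : t * t = a := Real.mul_self_sqrt ha.le
  have hle : ∀ y, √(V y) ≤ (V y / t + t) / 2 := by
    intro y
    have hs := Real.mul_self_sqrt (hV0 y)
    rw [le_div_iff₀ two_pos, ← sub_nonneg]
    have : V y / t + t - √(V y) * 2 = (√(V y) - t) ^ 2 / t := by
      rw [sub_sq, pow_two, hs]
      field_simp
      ring
    rw [this]
    positivity
  have hi : Integrable (fun y => (V y / t + t) / 2) ρ :=
    ((hVi.div_const t).add (integrable_const t)).div_const 2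
  have hsi : Integrable (fun y => √(V y)) ρ := hi.mono' hVm.sqrt.aestronglyMeasurable
    (.of_forall fun y => by rw [Real.norm_eq_abs, abs_of_nonneg (Real.sqrt_nonneg _)]; exact hle y)
  refine ⟨hsi, (integral_mono hsi hi hle).trans ?_⟩
  rw [integral_div, integral_add (hVi.div_const t) (integrable_const t), integral_div]
  simp only [integral_const, probReal_univ, smul_eq_mul, one_mul]
  have : (∫ y, V y ∂ρ) / t ≤ t := by
    rw [div_le_iff₀ ht0, hta]
    exact hVa
  linarith

/-- Drift for `V` implies drift for `√V`. The constant `b` may be negative; then `√b = 0`, which is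
still an admissible constant. -/
theorem geomDrift_sqrt {P : Kernel 𝒴 𝒴} [IsMarkovKernel P] {V : 𝒴 → ℝ} (hVm : Measurable V)
    (hV1 : ∀ y, 1 ≤ V y) {C : Set 𝒴} (hC : MeasurableSet C) {κ b δ : ℝ} (hκ0 : 0 < κ)
    (hκ1 : κ < 1) (hδ : 0 < δ)
    (hd : ∀ y, ∫⁻ z, ENNReal.ofReal (V z) ∂P y
      ≤ ENNReal.ofReal (κ * V y + C.indicator (fun _ => b) y))
    {η : Measure 𝒴} [IsProbabilityMeasure η] (hη : η Cᶜ = 0)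
    (hm : ∀ x ∈ C, ∀ A : Set 𝒴, MeasurableSet A → ENNReal.ofReal δ * η (A ∩ C) ≤ P x A) :
    GeomDrift P (fun y => √(V y)) C η (√κ) (√b) δ := by
  have hpos : ∀ y, 0 < κ * V y + C.indicator (fun _ => b) y := by
    intro y
    have h1 : (1 : ENNReal) ≤ ∫⁻ z, ENNReal.ofReal (V z) ∂P y := by
      calc (1 : ENNReal) = ∫⁻ z, 1 ∂P y := by simp
        _ ≤ _ := lintegral_mono fun z => by simpa using hV1 z
    exact ENNReal.ofReal_pos.1 (zero_lt_one.trans_le (h1.trans (hd y)))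
  have hJ := fun y => integral_sqrt_le (ρ := P y) hVm (fun y => zero_le_one.trans (hV1 y)) (hpos y)
    (hd y)
  refine ⟨hVm.sqrt, fun y => Real.one_le_sqrt.2 (hV1 y), hC, Real.sqrt_nonneg _,
    (Real.sqrt_lt' one_pos).2 (by simpa using hκ1), Real.sqrt_nonneg _, hδ, inferInstance,
    fun y => (hJ y).1, fun y => (hJ y).2.trans ?_, fun y hy => Measure.le_iff.2 fun A hA => ?_⟩
  · rw [← Real.sqrt_mul hκ0.le]
    by_cases hy : y ∈ C
    · simp only [Set.indicator_of_mem hy]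
      have hV := hV1 y
      rcases le_total 0 b with hb | hb
      · have hκV : 0 ≤ κ * V y := by positivity
        refine Real.sqrt_le_iff.2 ⟨by positivity, ?_⟩
        rw [add_sq, Real.sq_sqrt hκV, Real.sq_sqrt hb]
        have : 0 ≤ 2 * √(κ * V y) * √b := by positivity
        linarith
      · rw [Real.sqrt_eq_zero_of_nonpos hb, add_zero]
        exact Real.sqrt_le_sqrt (by linarith)
    · simp [Set.indicator_of_notMem hy]
  · have hAC : η (A ∩ C) = η A := measure_inter_conull hη
    rw [Measure.smul_apply, smul_eq_mul, ← hAC]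
    exact hm y hy A hA

/-- A jointly measurable family of solutions of the Poisson equations for the kernels `P_γ`, with
a bound that does not depend on `γ`. -/
theorem exists_poisson_family {P : Kernel (𝒴 × 𝓘) 𝒴} [IsMarkovKernel P] {W : 𝒴 → ℝ} {C : Set 𝒴}
    {lam b δ : ℝ} (D : ∀ γ, ∃ η, GeomDrift (P.sectL γ) W C η lam b δ) {π : 𝓘 → Measure 𝒴}
    [∀ γ, IsProbabilityMeasure (π γ)] (hinv : ∀ γ, (P.sectL γ).Invariant (π γ))
    (hW : ∀ γ, Integrable W (π γ)) (hC : ∀ γ, π γ C ≠ 0) {h : 𝒴 → ℝ} (hm : Measurable h)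
    (hc : ∀ y, |h y| ≤ W y) {a : ℝ} (ha : ∀ γ, ∫ y, h y ∂π γ = a) :
    ∃ (K : ℝ) (G : 𝒴 × 𝓘 → ℝ), Measurable G ∧ (∀ q, |G q| ≤ K * W q.1) ∧
      (∀ q, Integrable (fun z => G (z, q.2)) (P q)) ∧
      ∀ q, G q - ∫ z, G (z, q.2) ∂P q = h q.1 - a := by
  choose η D using D
  choose g gm gb ge gt using fun γ => (D γ).exists_poisson_tendsto (hinv γ) (hW γ) (hC γ) hm hc
  have hiter : ∀ n, Measurable fun q : 𝒴 × 𝓘 =>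
      kernelIter (P.sectL q.2) (fun z => h z - a) n q.1 := by
    intro n
    induction n with
    | zero => exact (hm.comp measurable_fst).sub_const a
    | succ n ih =>
      have h2 : Measurable fun r : (𝒴 × 𝓘) × 𝒴 =>
          kernelIter (P.sectL r.1.2) (fun z => h z - a) n r.2 :=
        ih.comp (measurable_snd.prodMk (measurable_snd.comp measurable_fst))
      exact (h2.stronglyMeasurable.integral_kernel_prod_right' (κ := P)).measurable
  refine ⟨_, fun q => g q.2 q.1, ?_, fun q => gb q.2 q.1,
    fun q => (D q.2).integrable_of_abs_le (gm q.2) (gb q.2) q.1, fun q => ?_⟩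
  · refine measurable_of_tendsto_metrizable (f := fun N q => (N : ℝ)⁻¹ *
      ∑ k ∈ Finset.range N, ∑ n ∈ Finset.range k,
        kernelIter (P.sectL q.2) (fun z => h z - a) n q.1) (fun N => ?_)
      (tendsto_pi_nhds.2 fun q => ?_)
    · exact (Finset.measurable_sum _ fun k _ => Finset.measurable_sum _ fun n _ =>
        hiter n).const_mul _
    · simpa only [ha] using gt q.2 q.1
  · have := ge q.2 q.1
    rwa [ha] at this

end Drift

/-! ### Series: Kronecker's lemma and almost sure convergence -/

section Series

/-- **Kronecker's lemma.** -/
theorem tendsto_sum_div_of_tendsto_sum {a x : ℕ → ℝ} {L : ℝ} (ha0 : a 0 = 0) (ham : Monotone a)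
    (hat : Tendsto a atTop atTop)
    (hx : Tendsto (fun n => ∑ k ∈ Finset.range n, x k) atTop (𝓝 L)) :
    Tendsto (fun n => (∑ k ∈ Finset.range (n + 1), a k * x k) / a n) atTop (𝓝 0) := by
  set S : ℕ → ℝ := fun n => ∑ k ∈ Finset.range n, x k with hS
  have hsum : ∀ n, ∑ k ∈ Finset.range n, (a (k + 1) - a k) = a n := fun n => by
    rw [Finset.sum_range_sub, ha0, sub_zero]
  -- Abel summation, with the limit `L` subtracted from the partial sums
  have abel : ∀ n, ∑ k ∈ Finset.range (n + 1), a k * x k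
      = a n * (S (n + 1) - L) - ∑ k ∈ Finset.range n, (a (k + 1) - a k) * (S (k + 1) - L) := by
    intro n
    induction n with
    | zero => simp [ha0]
    | succ n ih =>
      rw [Finset.sum_range_succ, ih, Finset.sum_range_succ _ n]
      simp only [hS, Finset.sum_range_succ _ (n + 1)]
      ring
  have hS1 : Tendsto (fun n => S (n + 1) - L) atTop (𝓝 0) := by
    have := ((tendsto_add_atTop_iff_nat 1).2 hx).sub_const L
    simpa using this
  have ho : (fun n => ∑ k ∈ Finset.range n, (a (k + 1) - a k) * (S (k + 1) - L)) =o[atTop] a := by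
    have h1 : (fun k => (a (k + 1) - a k) * (S (k + 1) - L)) =o[atTop]
        fun k => a (k + 1) - a k := by
      have := (Asymptotics.isBigO_refl (fun k => a (k + 1) - a k) atTop).mul_isLittleO
        ((Asymptotics.isLittleO_one_iff ℝ).2 hS1)
      simpa using this
    have h2 := h1.sum_range (fun k => sub_nonneg.2 (ham k.le_succ)) (by simpa only [hsum] using hat)
    simpa only [hsum] using h2
  have hlim := hS1.sub ho.tendsto_div_nhds_zero
  rw [sub_zero] at hlim
  refine hlim.congr' ?_
  filter_upwards [hat.eventually_gt_atTop 0] with n hn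
  rw [abel, sub_div, mul_div_cancel_left₀ _ hn.ne']

variable {Ω : Type*} {m0 : MeasurableSpace Ω} {μ : Measure Ω}

theorem ae_summable_of_integral_abs_le {F : ℕ → Ω → ℝ} (hi : ∀ k, Integrable (F k) μ) {v : ℕ → ℝ}
    (hv : Summable v) (hF : ∀ k, ∫ ω, |F k ω| ∂μ ≤ v k) :
    ∀ᵐ ω ∂μ, Summable fun k => F k ω := by
  have h1 : ∫⁻ ω, ∑' k, ‖F k ω‖ₑ ∂μ ≠ ⊤ := by
    rw [lintegral_tsum fun k => (hi k).aestronglyMeasurable.enorm]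
    refine ne_top_of_le_ne_top hv.tsum_ofReal_ne_top (ENNReal.tsum_le_tsum fun k => ?_)
    rw [← ofReal_integral_norm_eq_lintegral_enorm (hi k)]
    exact ENNReal.ofReal_le_ofReal (hF k)
  have h2 := ae_lt_top' (AEMeasurable.tsum
    fun k => (hi k).aestronglyMeasurable.enorm) h1
  filter_upwards [h2] with ω hω
  refine Summable.of_norm ?_
  simpa using ENNReal.summable_toReal hω.ne

/-- Convergence of a martingale with summable squared increments. The martingale property of the
increments `D` is expressed by their vanishing integrals over past events. -/
theorem ae_tendsto_sum_of_orthogonal [IsProbabilityMeasure μ] (ℱ : Filtration ℕ m0)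
    {D : ℕ → Ω → ℝ} (hD : ∀ n, StronglyMeasurable[ℱ (n + 1)] (D n)) (hL : ∀ n, MemLp (D n) 2 μ)
    (h0 : ∀ n, ∀ s, MeasurableSet[ℱ n] s → ∫ ω in s, D n ω ∂μ = 0) {v : ℕ → ℝ} (hv : Summable v)
    (hDv : ∀ n, ∫ ω, D n ω ^ 2 ∂μ ≤ v n) :
    ∀ᵐ ω ∂μ, ∃ L, Tendsto (fun n => ∑ k ∈ Finset.range n, D k ω) atTop (𝓝 L) := by
  set S : ℕ → Ω → ℝ := fun n ω => ∑ k ∈ Finset.range n, D k ω with hS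
  have hS1 : ∀ n, S (n + 1) = S n + D n := fun n => by
    funext ω
    simp [hS, Finset.sum_range_succ]
  have hSm : ∀ n, StronglyMeasurable[ℱ n] (S n) := fun n =>
    Finset.stronglyMeasurable_fun_sum _ fun k hk =>
      (hD k).mono (ℱ.mono (Nat.succ_le_of_lt (Finset.mem_range.1 hk)))
  have hSL : ∀ n, MemLp (S n) 2 μ := fun n => memLp_finsetSum _ fun k _ => hL k
  have hSi : ∀ n, Integrable (S n) μ := fun n => (hSL n).integrable one_le_two
  have hDi : ∀ n, Integrable (D n) μ := fun n => (hL n).integrable one_le_two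
  have hmart : Martingale S ℱ μ := martingale_of_setIntegral_eq_succ hSm hSi fun n s hs => by
    simp only [hS1, Pi.add_apply]
    rw [integral_add (hSi n).integrableOn (hDi n).integrableOn, h0 n s hs, add_zero]
  have hcond : ∀ n, μ[D n | ℱ n] =ᵐ[μ] 0 := fun n =>
    (ae_eq_condExp_of_forall_setIntegral_eq (ℱ.le n) (hDi n)
      (fun s _ _ => (integrable_zero _ _ _).integrableOn)
      (fun s hs _ => by simp [h0 n s hs]) aestronglyMeasurable_zero).symm
  have hSD : ∀ n, Integrable (S n * D n) μ := fun n => (hSL n).integrable_mul (hL n)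
  have hcross : ∀ n, ∫ ω, S n ω * D n ω ∂μ = 0 := fun n => by
    have h1 := condExp_mul_of_stronglyMeasurable_left (hSm n) (hSD n) (hDi n)
    have h2 : ∫ ω, (μ[S n * D n | ℱ n]) ω ∂μ = 0 := by
      rw [integral_congr_ae (g := fun _ => (0 : ℝ)) ?_, integral_zero]
      filter_upwards [h1, hcond n] with ω h3 h4
      rw [h3, Pi.mul_apply, h4, Pi.zero_apply, mul_zero]
    rw [integral_condExp (ℱ.le n)] at h2
    exact h2
  have hsq : ∀ n, ∫ ω, S n ω ^ 2 ∂μ ≤ ∑ k ∈ Finset.range n, v k := by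
    intro n
    induction n with
    | zero => simp [hS]
    | succ n ih =>
      have i1 : Integrable (fun ω => S n ω ^ 2) μ := (hSL n).integrable_sq
      have i2 : Integrable (fun ω => 2 * (S n ω * D n ω)) μ := (hSD n).const_mul 2
      have i3 : Integrable (fun ω => D n ω ^ 2) μ := (hL n).integrable_sq
      have i12 : Integrable (fun ω => S n ω ^ 2 + 2 * (S n ω * D n ω)) μ := i1.add i2
      have e : ∀ ω, S (n + 1) ω ^ 2 = S n ω ^ 2 + 2 * (S n ω * D n ω) + D n ω ^ 2 := fun ω => by
        rw [hS1, Pi.add_apply]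
        ring
      rw [integral_congr_ae (.of_forall e), integral_add i12 i3, integral_add i1 i2,
        integral_const_mul, hcross, Finset.sum_range_succ]
      linarith [hDv n]
  have hv0 : ∀ n, 0 ≤ v n := fun n => (integral_nonneg fun ω => sq_nonneg _).trans (hDv n)
  refine hmart.submartingale.exists_ae_tendsto_of_bdd (R := (1 + ∑' k, v k).toNNReal) fun n => ?_
  rw [eLpNorm_one_eq_lintegral_enorm, ← ofReal_integral_norm_eq_lintegral_enorm (hSi n)]
  refine ENNReal.ofReal_le_ofReal ?_
  have i1 : Integrable (fun ω => S n ω ^ 2) μ := (hSL n).integrable_sq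
  calc ∫ ω, ‖S n ω‖ ∂μ ≤ ∫ ω, (1 + S n ω ^ 2) ∂μ := by
        refine integral_mono (hSi n).norm ((integrable_const _).add i1) fun ω => ?_
        simp only [Real.norm_eq_abs]
        nlinarith [sq_abs (S n ω), sq_nonneg (|S n ω| - 1)]
    _ = 1 + ∫ ω, S n ω ^ 2 ∂μ := by
        rw [integral_add (integrable_const _) i1]
        simp
    _ ≤ 1 + ∑' k, v k :=
        add_le_add le_rfl ((hsq n).trans (hv.sum_le_tsum _ fun k _ => hv0 k))

/-- Variables with bounded second moments are `o(n ^ s)` almost surely, for every `s > 1 / 2`. -/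
theorem ae_tendsto_div_rpow_of_integral_sq_le {F : ℕ → Ω → ℝ} {B : ℝ}
    (hi : ∀ n, Integrable (fun ω => F n ω ^ 2) μ) (hB : ∀ n, ∫ ω, F n ω ^ 2 ∂μ ≤ B) {s : ℝ}
    (hs : 1 / 2 < s) : ∀ᵐ ω ∂μ, Tendsto (fun n : ℕ => F n ω / (n : ℝ) ^ s) atTop (𝓝 0) := by
  have hv : Summable fun n : ℕ => B * (1 / (n : ℝ) ^ (2 * s)) :=
    (Real.summable_one_div_nat_rpow.2 (by linarith)).mul_left B
  have h1 := ae_summable_of_integral_abs_le (μ := μ)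
    (F := fun n ω => F n ω ^ 2 * (1 / (n : ℝ) ^ (2 * s))) (fun n => (hi n).mul_const _) hv
    fun n => by
      have hn : (0 : ℝ) ≤ 1 / (n : ℝ) ^ (2 * s) := by positivity
      have e : ∀ ω, |F n ω ^ 2 * (1 / (n : ℝ) ^ (2 * s))| = F n ω ^ 2 * (1 / (n : ℝ) ^ (2 * s)) :=
        fun ω => abs_of_nonneg (mul_nonneg (sq_nonneg _) hn)
      simp only [e]
      rw [integral_mul_const]
      exact mul_le_mul_of_nonneg_right (hB n) hn
  filter_upwards [h1] with ω hω
  rw [tendsto_zero_iff_abs_tendsto_zero]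
  have h2 := (Real.continuous_sqrt.tendsto 0).comp hω.tendsto_atTop_zero
  rw [Real.sqrt_zero] at h2
  refine h2.congr fun n => ?_
  have e : F n ω ^ 2 * (1 / (n : ℝ) ^ (2 * s)) = (F n ω / (n : ℝ) ^ s) ^ 2 := by
    rw [mul_comm 2 s, Real.rpow_mul (Nat.cast_nonneg n), Real.rpow_two]
    ring
  simp only [Function.comp_apply, e, Real.sqrt_sq_eq_abs]

end Series

/-! ### Growth of the adaptation times -/

section AdaptTime

variable {β : ℝ}

theorem adaptTime_zero : adaptTime β 0 = 0 := by simp [adaptTime]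

theorem adaptTime_succ (m : ℕ) :
    adaptTime β (m + 1) = adaptTime β m + ⌈((m + 1 : ℕ) : ℝ) ^ β⌉₊ := by
  unfold adaptTime
  rw [Finset.sum_Icc_succ_top (by omega)]

theorem strictMono_adaptTime : StrictMono (adaptTime β) := by
  refine strictMono_nat_of_lt_succ fun m => ?_
  rw [adaptTime_succ]
  refine Nat.lt_add_of_pos_right (Nat.ceil_pos.2 ?_)
  positivity

theorem exists_mem_Ico_adaptTime (n : ℕ) :
    ∃ m, n ∈ Set.Ico (adaptTime β m) (adaptTime β (m + 1)) := by
  induction n with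
  | zero =>
    refine ⟨0, by simp [adaptTime_zero], ?_⟩
    have := strictMono_adaptTime (β := β) zero_lt_one
    rwa [adaptTime_zero] at this
  | succ n ih =>
    obtain ⟨m, h1, h2⟩ := ih
    rcases Nat.lt_or_ge (n + 1) (adaptTime β (m + 1)) with h | h
    · exact ⟨m, by omega, h⟩
    · have := strictMono_adaptTime (β := β) (Nat.lt_add_one (m + 1))
      exact ⟨m + 1, h, by omega⟩

/-- The adaptation times grow at least like `∫₀ᵐ x ^ β dx`. -/
theorem rpow_div_le_adaptTime (hβ : 0 < β) (m : ℕ) :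
    (m : ℝ) ^ (1 + β) / (1 + β) ≤ adaptTime β m := by
  induction m with
  | zero => simp [adaptTime_zero, Real.zero_rpow (by positivity : 1 + β ≠ 0)]
  | succ m ih =>
    have hm : (0 : ℝ) < (m + 1 : ℕ) := by positivity
    -- Bernoulli's inequality at `-1 / (m + 1)`
    have hB := one_add_mul_self_le_rpow_one_add (s := -1 / ((m + 1 : ℕ) : ℝ))
      (by rw [le_div_iff₀ hm]; push_cast; linarith [Nat.cast_nonneg (α := ℝ) m])
      (p := 1 + β) (by linarith)
    have e : 1 + -1 / ((m + 1 : ℕ) : ℝ) = (m : ℝ) / ((m + 1 : ℕ) : ℝ) := by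
      push_cast
      field_simp
      ring
    rw [e, Real.div_rpow (by positivity) hm.le, le_div_iff₀ (by positivity)] at hB
    have h2 : ((m + 1 : ℕ) : ℝ) ^ (1 + β) = ((m + 1 : ℕ) : ℝ) * ((m + 1 : ℕ) : ℝ) ^ β := by
      rw [Real.rpow_add hm, Real.rpow_one]
    have h3 : (1 + (1 + β) * (-1 / ((m + 1 : ℕ) : ℝ))) * ((m + 1 : ℕ) : ℝ) ^ (1 + β)
        = ((m + 1 : ℕ) : ℝ) ^ (1 + β) - (1 + β) * ((m + 1 : ℕ) : ℝ) ^ β := by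
      rw [h2]
      field_simp
      ring
    rw [h3] at hB
    have hT : (adaptTime β (m + 1) : ℝ) = adaptTime β m + (⌈((m + 1 : ℕ) : ℝ) ^ β⌉₊ : ℝ) := by
      rw [adaptTime_succ]
      exact Nat.cast_add _ _
    rw [hT]
    have h4 : (m : ℝ) ^ (1 + β) ≤ (1 + β) * adaptTime β m := by
      rwa [div_le_iff₀' (by positivity)] at ih
    have h5 : ((m + 1 : ℕ) : ℝ) ^ β ≤ (⌈((m + 1 : ℕ) : ℝ) ^ β⌉₊ : ℝ) := Nat.le_ceil _
    rw [div_le_iff₀' (by positivity)]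
    have := mul_le_mul_of_nonneg_left h5 (by positivity : 0 ≤ 1 + β)
    linarith

theorem summable_one_div_adaptTime_rpow (hβ : 0 < β) {s : ℝ} (hs0 : 0 < s)
    (hs : 1 < (1 + β) * s) : Summable fun m => 1 / (adaptTime β m : ℝ) ^ s := by
  have h1 : Summable fun m : ℕ => (1 + β) ^ s * (1 / (m : ℝ) ^ ((1 + β) * s)) :=
    (Real.summable_one_div_nat_rpow.2 hs).mul_left _
  refine h1.of_nonneg_of_le (fun m => by positivity) fun m => ?_
  rcases Nat.eq_zero_or_pos m with rfl | hm
  · simp only [adaptTime_zero, Nat.cast_zero, Real.zero_rpow hs0.ne', div_zero]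
    positivity
  · have hm' : (0 : ℝ) < m := by exact_mod_cast hm
    have h2 := Real.rpow_le_rpow (by positivity) (rpow_div_le_adaptTime hβ m) hs0.le
    rw [Real.div_rpow (by positivity) (by positivity), ← Real.rpow_mul hm'.le] at h2
    rw [mul_one_div, one_div_le (lt_of_lt_of_le (by positivity) h2) (by positivity), one_div_div]
    exact h2

/-- Over the set of the times `k` just before an adaptation time, `∑ k ^ (-s)` converges. -/
theorem summable_indicator_adaptTime (hβ : 0 < β) {s : ℝ} (hs0 : 0 < s) (hs : 1 < (1 + β) * s) :
    Summable ({k : ℕ | k + 1 ∈ Set.range (adaptTime β)}.indicator fun k : ℕ => 1 / (k : ℝ) ^ s) := by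
  have h1 : Summable ((Set.range (adaptTime β)).indicator fun k : ℕ => 1 / (k : ℝ) ^ s) := by
    rw [← strictMono_adaptTime.injective.summable_iff (fun x hx => Set.indicator_of_notMem hx _)]
    refine (summable_one_div_adaptTime_rpow hβ hs0 hs).congr fun m => ?_
    simp
  have h2 := ((summable_nat_add_iff 1).2 h1).mul_left ((2 : ℝ) ^ s)
  refine h2.of_nonneg_of_le (fun k => Set.indicator_nonneg (fun k _ => by positivity) k) fun k => ?_
  by_cases hk : k + 1 ∈ Set.range (adaptTime β)
  · rw [Set.indicator_of_mem hk, Set.indicator_of_mem (by exact hk)]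
    rcases Nat.eq_zero_or_pos k with rfl | hk0
    · simp only [Nat.cast_zero, Real.zero_rpow hs0.ne', div_zero]
      positivity
    · have hk0' : (1 : ℝ) ≤ k := by exact_mod_cast hk0
      have h3 : ((k + 1 : ℕ) : ℝ) ^ s ≤ (2 : ℝ) ^ s * (k : ℝ) ^ s := by
        rw [← Real.mul_rpow two_pos.le (by positivity)]
        exact Real.rpow_le_rpow (by positivity) (by push_cast; linarith) hs0.le
      rw [mul_one_div, div_le_div_iff₀ (by positivity) (by positivity), one_mul]
      exact h3
  · rw [Set.indicator_of_notMem (by exact hk), Set.indicator_of_notMem hk]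
    simp

end AdaptTime

/-! ### The adaptive chain -/

section ChainLemmas

variable {Ω 𝒴 𝓘 : Type*} [MeasurableSpace 𝒴] [MeasurableSpace 𝓘]
  {Y : ℕ → Ω → 𝒴} {Γ : ℕ → Ω → 𝓘}

theorem measurable_state_history {i n : ℕ} (h : i ≤ n) : Measurable[history Y Γ n] (Y i) := by
  refine (comap_measurable (Y i)).mono ?_ le_rfl
  exact le_sup_left.trans (le_iSup₂_of_le (f := fun i (_ : i ∈ Finset.range (n + 1)) =>
    MeasurableSpace.comap (Y i) inferInstance ⊔ MeasurableSpace.comap (Γ i) inferInstance)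
    i (Finset.mem_range.2 (by omega)) le_rfl)

theorem measurable_param_history {i n : ℕ} (h : i ≤ n) : Measurable[history Y Γ n] (Γ i) := by
  refine (comap_measurable (Γ i)).mono ?_ le_rfl
  exact le_sup_right.trans (le_iSup₂_of_le (f := fun i (_ : i ∈ Finset.range (n + 1)) =>
    MeasurableSpace.comap (Y i) inferInstance ⊔ MeasurableSpace.comap (Γ i) inferInstance)
    i (Finset.mem_range.2 (by omega)) le_rfl)

namespace IsAIRChain

variable [m0 : MeasurableSpace Ω] {μ : Measure Ω} {P : Kernel (𝒴 × 𝓘) 𝒴} {β : ℝ}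
variable (hY : IsAIRChain μ P β Y Γ)
include hY

theorem history_le (n : ℕ) : history Y Γ n ≤ m0 :=
  iSup₂_le fun i _ =>
    sup_le (hY.measurable_state i).comap_le (hY.measurable_param i).comap_le

/-- The natural filtration of the chain and its adaptation parameters. -/
def filtration : Filtration ℕ m0 where
  seq := history Y Γ
  mono' := fun _ _ h => biSup_mono fun _ hi =>
    Finset.mem_range.2 ((Finset.mem_range.1 hi).trans_le (by omega))
  le' := hY.history_le

theorem measurable_pair (n : ℕ) : Measurable fun ω => (Y n ω, Γ n ω) :=
  (hY.measurable_state n).prodMk (hY.measurable_param n)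

variable [IsProbabilityMeasure μ] [IsMarkovKernel P]

/-- The transition property in disintegrated form: on any past event, the joint law of the current
pair and the next state is the composition-product with `P`. -/
theorem map_restrict_eq_compProd (n : ℕ) {A : Set Ω} (hA : MeasurableSet[history Y Γ n] A) :
    (μ.restrict A).map (fun ω => ((Y n ω, Γ n ω), Y (n + 1) ω))
      = (μ.restrict A).map (fun ω => (Y n ω, Γ n ω)) ⊗ₘ P := by
  have hZ := hY.measurable_pair n
  have hY1 := hY.measurable_state (n + 1)
  have hle := hY.history_le n
  refine Measure.ext_prod fun {s t} hs ht => ?_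
  have hZh : MeasurableSet[history Y Γ n] ((fun ω => (Y n ω, Γ n ω)) ⁻¹' s) :=
    ((measurable_state_history le_rfl).prodMk (measurable_param_history le_rfl)) hs
  have hB : MeasurableSet[history Y Γ n] (A ∩ (fun ω => (Y n ω, Γ n ω)) ⁻¹' s) := hA.inter hZh
  have hPm : Measurable fun ω => P (Y n ω, Γ n ω) t := (P.measurable_coe ht).comp hZ
  rw [Measure.map_apply (hZ.prodMk hY1) (hs.prod ht), Measure.compProd_apply_prod hs ht,
    setLIntegral_map hs (P.measurable_coe ht) hZ, Measure.restrict_restrict (hle _ hZh)]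
  have h1 : ∫ ω in (fun ω => (Y n ω, Γ n ω)) ⁻¹' s ∩ A, (P (Y n ω, Γ n ω) t).toReal ∂μ
      = (μ.restrict A).real ((fun ω => ((Y n ω, Γ n ω), Y (n + 1) ω)) ⁻¹' s ×ˢ t) := by
    rw [Set.inter_comm, ← setIntegral_congr_ae (g := fun ω => (P (Y n ω, Γ n ω) t).toReal)
      (hle _ hB) ((hY.transition n t ht).mono fun ω h _ => h),
      setIntegral_condExp hle ((integrable_const _).indicator (hY1 ht)) hB,
      setIntegral_indicator (hY1 ht), setIntegral_const, smul_eq_mul, mul_one, measureReal_def,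
      measureReal_def, Measure.restrict_apply ((hZ.prodMk hY1) (hs.prod ht))]
    congr 2
    ext ω
    simp only [Set.mem_inter_iff, Set.mem_preimage, Set.mem_prod]
    tauto
  rw [integral_toReal hPm.aemeasurable (.of_forall fun ω => measure_lt_top _ _)] at h1
  rw [measureReal_def, ENNReal.toReal_eq_toReal_iff' ?_ (measure_ne_top _ _)] at h1
  · exact h1.symm
  · refine ne_top_of_le_ne_top (measure_ne_top μ ((fun ω => (Y n ω, Γ n ω)) ⁻¹' s ∩ A)) ?_
    calc ∫⁻ ω in (fun ω => (Y n ω, Γ n ω)) ⁻¹' s ∩ A, P (Y n ω, Γ n ω) t ∂μ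
        ≤ ∫⁻ ω in (fun ω => (Y n ω, Γ n ω)) ⁻¹' s ∩ A, 1 ∂μ := lintegral_mono fun ω => prob_le_one
      _ = _ := by simp

theorem lintegral_state_succ (n : ℕ) {F : 𝒴 → ENNReal} (hF : Measurable F) :
    ∫⁻ ω, F (Y (n + 1) ω) ∂μ = ∫⁻ ω, ∫⁻ z, F z ∂P (Y n ω, Γ n ω) ∂μ := by
  have h1 := hY.map_restrict_eq_compProd n MeasurableSet.univ
  rw [Measure.restrict_univ] at h1
  have hF2 : Measurable fun q : (𝒴 × 𝓘) × 𝒴 => F q.2 := hF.comp measurable_snd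
  have h2 := lintegral_map (μ := μ) hF2 ((hY.measurable_pair n).prodMk (hY.measurable_state (n + 1)))
  rw [h1, Measure.lintegral_compProd hF2, lintegral_map hF.lintegral_kernel (hY.measurable_pair n)]
    at h2
  exact h2.symm

/-- A function of the current pair and the next state that is centred under every `P q` has
vanishing integral over past events. -/
theorem setIntegral_eq_zero (n : ℕ) {F : (𝒴 × 𝓘) × 𝒴 → ℝ} (hF : Measurable F)
    (h0 : ∀ q, ∫ z, F (q, z) ∂P q = 0)
    (hi : Integrable (fun ω => F ((Y n ω, Γ n ω), Y (n + 1) ω)) μ) {A : Set Ω}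
    (hA : MeasurableSet[history Y Γ n] A) :
    ∫ ω in A, F ((Y n ω, Γ n ω), Y (n + 1) ω) ∂μ = 0 := by
  have hm := (hY.measurable_pair n).prodMk (hY.measurable_state (n + 1))
  have h1 := hY.map_restrict_eq_compProd n hA
  have hi2 : Integrable F ((μ.restrict A).map (fun ω => ((Y n ω, Γ n ω), Y (n + 1) ω))) :=
    (integrable_map_measure hF.aestronglyMeasurable hm.aemeasurable).2 hi.integrableOn
  have h2 := integral_map (μ := μ.restrict A) hm.aemeasurable hF.aestronglyMeasurable
  rw [← h2, h1, Measure.integral_compProd (h1 ▸ hi2)]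
  simp [h0]

/-- The drift inequality keeps the moments `E V (Y n)` bounded. -/
theorem exists_integral_le {V : 𝒴 → ℝ} (hVm : Measurable V) (hV0 : ∀ y, 0 ≤ V y) {C : Set 𝒴}
    {κ b : ℝ} (hκ0 : 0 ≤ κ) (hκ1 : κ < 1)
    (hd : ∀ q : 𝒴 × 𝓘, ∫⁻ z, ENNReal.ofReal (V z) ∂P q
      ≤ ENNReal.ofReal (κ * V q.1 + C.indicator (fun _ => b) q.1)) :
    ∃ B : ℝ, ∀ n, Integrable (fun ω => V (Y n ω)) μ ∧ ∫ ω, V (Y n ω) ∂μ ≤ B := by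
  obtain ⟨y₀, γ₀, h0⟩ := hY.initial
  have h1 : 0 < 1 - κ := sub_pos.2 hκ1
  set b' := max b 0 with hb'
  have hb0 : 0 ≤ b' := le_max_right _ _
  set B := V y₀ + b' / (1 - κ) with hB
  have hB0 : 0 ≤ B := add_nonneg (hV0 _) (by positivity)
  have hstep : κ * B + b' ≤ B := by
    have : b' = (1 - κ) * (b' / (1 - κ)) := by field_simp
    nlinarith [mul_nonneg h1.le (hV0 y₀)]
  have hlin : ∀ n, ∫⁻ ω, ENNReal.ofReal (V (Y n ω)) ∂μ ≤ ENNReal.ofReal B := by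
    intro n
    induction n with
    | zero =>
      rw [lintegral_congr_ae (g := fun _ => ENNReal.ofReal (V y₀))
        (h0.mono fun ω h => by simp only [h.1])]
      simp only [lintegral_const, measure_univ, mul_one]
      exact ENNReal.ofReal_le_ofReal (le_add_of_nonneg_right (by positivity))
    | succ n ih =>
      have hm : Measurable fun ω => ENNReal.ofReal (V (Y n ω)) :=
        (hVm.comp (hY.measurable_state n)).ennreal_ofReal
      rw [hY.lintegral_state_succ n hVm.ennreal_ofReal]
      calc ∫⁻ ω, ∫⁻ z, ENNReal.ofReal (V z) ∂P (Y n ω, Γ n ω) ∂μ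
          ≤ ∫⁻ ω, (ENNReal.ofReal κ * ENNReal.ofReal (V (Y n ω)) + ENNReal.ofReal b') ∂μ := by
            refine lintegral_mono fun ω => (hd _).trans ?_
            rw [← ENNReal.ofReal_mul hκ0, ← ENNReal.ofReal_add (mul_nonneg hκ0 (hV0 _)) hb0]
            refine ENNReal.ofReal_le_ofReal (add_le_add le_rfl ?_)
            exact Set.indicator_apply_le' (fun _ => le_max_left _ _) fun _ => hb0
        _ = ENNReal.ofReal κ * ∫⁻ ω, ENNReal.ofReal (V (Y n ω)) ∂μ + ENNReal.ofReal b' := by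
            rw [lintegral_add_right _ measurable_const, lintegral_const_mul _ hm]
            simp
        _ ≤ ENNReal.ofReal κ * ENNReal.ofReal B + ENNReal.ofReal b' := by gcongr
        _ = ENNReal.ofReal (κ * B + b') := by
            rw [← ENNReal.ofReal_mul hκ0, ← ENNReal.ofReal_add (mul_nonneg hκ0 hB0) hb0]
        _ ≤ ENNReal.ofReal B := ENNReal.ofReal_le_ofReal hstep
  refine ⟨B, fun n => ?_⟩
  have hm : Measurable fun ω => V (Y n ω) := hVm.comp (hY.measurable_state n)
  have hn : 0 ≤ᵐ[μ] fun ω => V (Y n ω) := .of_forall fun ω => hV0 _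
  refine ⟨⟨hm.aestronglyMeasurable, ?_⟩, ?_⟩
  · rw [hasFiniteIntegral_iff_ofReal hn]
    exact (hlin n).trans_lt ENNReal.ofReal_lt_top
  · rw [integral_eq_lintegral_of_nonneg_ae hn hm.aestronglyMeasurable]
    exact ENNReal.toReal_le_of_le_ofReal hB0 (hlin n)

omit [IsProbabilityMeasure μ] [IsMarkovKernel P] in
/-- The adaptation parameter does not move except into an adaptation time. -/
theorem ae_param_succ_eq {k : ℕ} (hk : k + 1 ∉ Set.range (adaptTime β)) :
    ∀ᵐ ω ∂μ, Γ (k + 1) ω = Γ k ω := by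
  obtain ⟨m, h1, h2⟩ := exists_mem_Ico_adaptTime (β := β) (k + 1)
  have h3 : adaptTime β m ≠ k + 1 := fun h => hk ⟨m, h⟩
  exact hY.rare m (k + 1) ⟨h1, h2⟩ k ⟨by omega, by omega⟩

end IsAIRChain

end ChainLemmas

/-! ### The martingale decomposition of the ergodic sums -/

section Decomposition

variable {Ω 𝒴 𝓘 : Type*} [MeasurableSpace 𝒴] [MeasurableSpace 𝓘] [m0 : MeasurableSpace Ω]
  {μ : Measure Ω} {P : Kernel (𝒴 × 𝓘) 𝒴} {β : ℝ} {Y : ℕ → Ω → 𝒴} {Γ : ℕ → Ω → 𝓘}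

/-- `poissonIncrement G h a ((y, γ), z)` is the centred increment `G_γ(z) - P_γ G_γ(y)` of a
solution `G_γ` of the Poisson equation, with `P_γ G_γ(y)` written as `G_γ(y) - (h y - a)`. -/
def poissonIncrement (G : 𝒴 × 𝓘 → ℝ) (h : 𝒴 → ℝ) (a : ℝ) (r : (𝒴 × 𝓘) × 𝒴) : ℝ :=
  G (r.2, r.1.2) - (G r.1 - (h r.1.1 - a))

/-- The error made by replacing `Γ n` with `Γ (n + 1)` at the state `Y (n + 1)`. -/
def adaptError (G : 𝒴 × 𝓘 → ℝ) (Y : ℕ → Ω → 𝒴) (Γ : ℕ → Ω → 𝓘) (n : ℕ) (ω : Ω) : ℝ :=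
  G (Y (n + 1) ω, Γ (n + 1) ω) - G (Y (n + 1) ω, Γ n ω)

theorem measurable_poissonIncrement {G : 𝒴 × 𝓘 → ℝ} (hG : Measurable G) {h : 𝒴 → ℝ}
    (hm : Measurable h) (a : ℝ) : Measurable (poissonIncrement G h a) :=
  (hG.comp (measurable_snd.prodMk (measurable_snd.comp measurable_fst))).sub
    ((hG.comp measurable_fst).sub ((hm.comp (measurable_fst.comp measurable_fst)).sub_const a))

omit [MeasurableSpace 𝒴] [MeasurableSpace 𝓘] m0 in
/-- The exact decomposition of the ergodic sum into increments, adaptation errors and a boundary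
term. -/
theorem sum_sub_eq (G : 𝒴 × 𝓘 → ℝ) (h : 𝒴 → ℝ) (a : ℝ) (n : ℕ) (ω : Ω) :
    ∑ j ∈ Finset.Icc 1 n, (h (Y j ω) - a)
      = ∑ j ∈ Finset.Icc 1 n, (poissonIncrement G h a ((Y j ω, Γ j ω), Y (j + 1) ω)
          + adaptError G Y Γ j ω)
        + (G (Y 1 ω, Γ 1 ω) - G (Y (n + 1) ω, Γ (n + 1) ω)) := by
  induction n with
  | zero => simp
  | succ n ih =>
    rw [Finset.sum_Icc_succ_top (by omega), Finset.sum_Icc_succ_top (by omega), ih]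
    simp only [poissonIncrement, adaptError]
    ring

namespace IsAIRChain

variable [IsProbabilityMeasure μ] [IsMarkovKernel P] (hY : IsAIRChain μ P β Y Γ)
  {V : 𝒴 → ℝ} (hV1 : ∀ y, 1 ≤ V y) {B : ℝ}
  (hB : ∀ n, Integrable (fun ω => V (Y n ω)) μ ∧ ∫ ω, V (Y n ω) ∂μ ≤ B)
  {G : 𝒴 × 𝓘 → ℝ} (hG : Measurable G) {K : ℝ} (hK : 0 ≤ K) (hGK : ∀ q, |G q| ≤ K * √(V q.1))
include hY hV1 hB hG hGK

omit [IsProbabilityMeasure μ] [IsMarkovKernel P] in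
theorem integral_sq_le (n : ℕ) :
    Integrable (fun ω => G (Y n ω, Γ n ω) ^ 2) μ ∧
      ∫ ω, G (Y n ω, Γ n ω) ^ 2 ∂μ ≤ K ^ 2 * B := by
  have hle : ∀ ω, G (Y n ω, Γ n ω) ^ 2 ≤ K ^ 2 * V (Y n ω) := fun ω => by
    have h1 := pow_le_pow_left₀ (abs_nonneg _) (hGK (Y n ω, Γ n ω)) 2
    rwa [sq_abs, mul_pow, Real.sq_sqrt (zero_le_one.trans (hV1 _))] at h1
  have hi : Integrable (fun ω => G (Y n ω, Γ n ω) ^ 2) μ :=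
    ((hB n).1.const_mul (K ^ 2)).mono'
      ((hG.comp (hY.measurable_pair n)).pow_const 2).aestronglyMeasurable
      (.of_forall fun ω => by rw [Real.norm_eq_abs, abs_of_nonneg (sq_nonneg _)]; exact hle ω)
  refine ⟨hi, (integral_mono hi ((hB n).1.const_mul _) hle).trans ?_⟩
  rw [integral_const_mul]
  exact mul_le_mul_of_nonneg_left (hB n).2 (sq_nonneg K)

include hK

omit [IsProbabilityMeasure μ] [IsMarkovKernel P] in
/-- The adaptation errors are summable after division by `k ^ s`, since they vanish except at
adaptation times and these are sparse. -/
theorem ae_summable_adaptError (hβ : 0 < β) {s : ℝ} (hs0 : 0 < s) (hs : 1 < (1 + β) * s) :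
    ∀ᵐ ω ∂μ, Summable fun k : ℕ => adaptError G Y Γ k ω / (k : ℝ) ^ s := by
  have hm : ∀ k, Measurable (adaptError G Y Γ k) := fun k =>
    (hG.comp (hY.measurable_pair (k + 1))).sub
      (hG.comp ((hY.measurable_state (k + 1)).prodMk (hY.measurable_param k)))
  have hle : ∀ k ω, |adaptError G Y Γ k ω| ≤ 2 * K * V (Y (k + 1) ω) := fun k ω => by
    have hVs : √(V (Y (k + 1) ω)) ≤ V (Y (k + 1) ω) :=
      Real.sqrt_le_iff.2 ⟨zero_le_one.trans (hV1 _), le_self_pow₀ (hV1 _) two_ne_zero⟩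
    have h1 := (abs_sub _ _).trans (add_le_add (hGK (Y (k + 1) ω, Γ (k + 1) ω))
      (hGK (Y (k + 1) ω, Γ k ω)))
    have h2 := mul_le_mul_of_nonneg_left hVs hK
    simp only [adaptError]
    linarith
  have hi : ∀ k, Integrable (adaptError G Y Γ k) μ := fun k =>
    ((hB (k + 1)).1.const_mul (2 * K)).mono' (hm k).aestronglyMeasurable (.of_forall (hle k))
  refine ae_summable_of_integral_abs_le (fun k => (hi k).div_const _)
    ((summable_indicator_adaptTime hβ hs0 hs).mul_left (2 * K * B)) fun k => ?_
  by_cases hk : k + 1 ∈ Set.range (adaptTime β)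
  · rw [Set.indicator_of_mem (by exact hk)]
    have hks : (0 : ℝ) ≤ (k : ℝ) ^ s := by positivity
    simp only [abs_div, abs_of_nonneg hks]
    rw [integral_div, mul_one_div]
    refine div_le_div_of_nonneg_right ?_ hks
    refine (integral_mono (hi k).abs ((hB (k + 1)).1.const_mul (2 * K)) (hle k)).trans ?_
    rw [integral_const_mul]
    exact mul_le_mul_of_nonneg_left (hB (k + 1)).2 (by positivity)
  · rw [Set.indicator_of_notMem (by exact hk), mul_zero, integral_congr_ae (g := fun _ => (0 : ℝ)),
      integral_zero]
    filter_upwards [hY.ae_param_succ_eq hk] with ω hω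
    simp [adaptError, hω]

variable {h : 𝒴 → ℝ} (hm : Measurable h) (hhV : ∀ y, |h y| ≤ √(V y)) {a : ℝ}
  (hGi : ∀ q, Integrable (fun z => G (z, q.2)) (P q))
  (hP : ∀ q, G q - ∫ z, G (z, q.2) ∂P q = h q.1 - a)
include hm hhV hGi hP

theorem ae_tendsto_sum_poissonIncrement {s : ℝ} (hs : 1 / 2 < s) :
    ∀ᵐ ω ∂μ, ∃ L, Tendsto (fun n => ∑ k ∈ Finset.range n,
      poissonIncrement G h a ((Y k ω, Γ k ω), Y (k + 1) ω) / (k : ℝ) ^ s) atTop (𝓝 L) := by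
  set D : ℕ → Ω → ℝ := fun k ω => poissonIncrement G h a ((Y k ω, Γ k ω), Y (k + 1) ω) with hD
  have hpm := measurable_poissonIncrement hG hm a
  have hDm : ∀ k, Measurable (D k) := fun k =>
    hpm.comp ((hY.measurable_pair k).prodMk (hY.measurable_state (k + 1)))
  have hDh : ∀ k, Measurable[history Y Γ (k + 1)] (D k) := fun k =>
    hpm.comp (((measurable_state_history k.le_succ).prodMk
      (measurable_param_history k.le_succ)).prodMk (measurable_state_history le_rfl))
  set K' := K + 1 + |a| with hK'
  have hK'0 : 0 ≤ K' := by positivity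
  have hDle : ∀ k ω, |D k ω| ≤ K' * (√(V (Y (k + 1) ω)) + √(V (Y k ω))) := fun k ω => by
    have h1 : |D k ω| ≤ K * √(V (Y (k + 1) ω)) + (K * √(V (Y k ω)) + (√(V (Y k ω)) + |a|)) :=
      (abs_sub _ _).trans (add_le_add (hGK _) ((abs_sub _ _).trans (add_le_add (hGK _)
        ((abs_sub _ _).trans (add_le_add (hhV _) le_rfl)))))
    have h2 : 1 ≤ √(V (Y k ω)) := Real.one_le_sqrt.2 (hV1 _)
    have h3 : 0 ≤ √(V (Y (k + 1) ω)) := Real.sqrt_nonneg _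
    have h4 := mul_le_mul_of_nonneg_left h2 (abs_nonneg a)
    have h5 : 0 ≤ (1 + |a|) * √(V (Y (k + 1) ω)) := by positivity
    rw [hK']
    linarith
  have hDsq : ∀ k ω, D k ω ^ 2 ≤ 2 * K' ^ 2 * (V (Y (k + 1) ω) + V (Y k ω)) := fun k ω => by
    have h1 := pow_le_pow_left₀ (abs_nonneg _) (hDle k ω) 2
    have h2 := Real.sq_sqrt (zero_le_one.trans (hV1 (Y (k + 1) ω)))
    have h3 := Real.sq_sqrt (zero_le_one.trans (hV1 (Y k ω)))
    rw [sq_abs, mul_pow] at h1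
    have h4 : (√(V (Y (k + 1) ω)) + √(V (Y k ω))) ^ 2 ≤ 2 * (V (Y (k + 1) ω) + V (Y k ω)) := by
      rw [← h2, ← h3, Real.sqrt_sq (Real.sqrt_nonneg _), Real.sqrt_sq (Real.sqrt_nonneg _)]
      exact add_sq_le
    have h5 := mul_le_mul_of_nonneg_left h4 (sq_nonneg K')
    linarith
  have hVi : ∀ k, Integrable (fun ω => 2 * K' ^ 2 * (V (Y (k + 1) ω) + V (Y k ω))) μ := fun k =>
    ((hB (k + 1)).1.add (hB k).1).const_mul _
  have hDsqi : ∀ k, Integrable (fun ω => D k ω ^ 2) μ := fun k =>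
    (hVi k).mono' ((hDm k).pow_const 2).aestronglyMeasurable
      (.of_forall fun ω => by rw [Real.norm_eq_abs, abs_of_nonneg (sq_nonneg _)]; exact hDsq k ω)
  have hDsqB : ∀ k, ∫ ω, D k ω ^ 2 ∂μ ≤ 4 * K' ^ 2 * B := fun k => by
    refine (integral_mono (hDsqi k) (hVi k) (hDsq k)).trans ?_
    rw [integral_const_mul, integral_add (hB (k + 1)).1 (hB k).1]
    have := mul_le_mul_of_nonneg_left (add_le_add (hB (k + 1)).2 (hB k).2)
      (by positivity : 0 ≤ 2 * K' ^ 2)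
    linarith
  have hDL : ∀ k, MemLp (D k) 2 μ := fun k =>
    (memLp_two_iff_integrable_sq (hDm k).aestronglyMeasurable).2 (hDsqi k)
  have hcent : ∀ q, ∫ z, poissonIncrement G h a (q, z) ∂P q = 0 := fun q => by
    simp only [poissonIncrement, ← hP q]
    rw [integral_sub (hGi q) (integrable_const _)]
    simp
  refine ae_tendsto_sum_of_orthogonal (μ := μ) hY.filtration
    (D := fun k ω => D k ω / (k : ℝ) ^ s) (v := fun k => 4 * K' ^ 2 * B * (1 / (k : ℝ) ^ (2 * s)))
    (fun k => ((hDh k).div_const _).stronglyMeasurable) (fun k => (hDL k).mul_const _) ?_ ?_ ?_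
  · intro k A hA
    rw [integral_div, hY.setIntegral_eq_zero k hpm hcent ((hDL k).integrable one_le_two) hA,
      zero_div]
  · exact (Real.summable_one_div_nat_rpow.2 (by linarith)).mul_left _
  · intro k
    simp only [div_pow]
    rw [integral_div, mul_comm 2 s, Real.rpow_mul (Nat.cast_nonneg k), Real.rpow_two, mul_one_div]
    exact div_le_div_of_nonneg_right (hDsqB k) (by positivity)

/-- The ergodic sums of an AIR chain, given a family of solutions of the Poisson equations. -/
theorem ae_tendsto_ergodic_sum (hβ : 0 < β) {s : ℝ} (hs : 1 / 2 < s) (hsβ : 1 < (1 + β) * s) :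
    ∀ᵐ ω ∂μ, Tendsto (fun n : ℕ => 1 / (n : ℝ) ^ s * ∑ j ∈ Finset.Icc 1 n, (h (Y j ω) - a))
      atTop (𝓝 0) := by
  have hs0 : 0 < s := by linarith
  have hbd := ae_tendsto_div_rpow_of_integral_sq_le (μ := μ)
    (F := fun n ω => G (Y (n + 1) ω, Γ (n + 1) ω))
    (fun n => (hY.integral_sq_le hV1 hB hG hGK (n + 1)).1)
    (fun n => (hY.integral_sq_le hV1 hB hG hGK (n + 1)).2) hs
  filter_upwards [hY.ae_tendsto_sum_poissonIncrement hV1 hB hG hK hGK hm hhV hGi hP hs,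
    hY.ae_summable_adaptError hV1 hB hG hK hGK hβ hs0 hsβ, hbd] with ω ⟨L, h1⟩ h2 h3
  have hat : Tendsto (fun n : ℕ => (n : ℝ) ^ s) atTop atTop :=
    (tendsto_rpow_atTop hs0).comp tendsto_natCast_atTop_atTop
  have hsum := h1.add h2.hasSum.tendsto_sum_nat
  simp only [← Finset.sum_add_distrib] at hsum
  have hkr := tendsto_sum_div_of_tendsto_sum (a := fun n : ℕ => (n : ℝ) ^ s)
    (by simp [Real.zero_rpow hs0.ne'])
    (fun i j hij => Real.rpow_le_rpow (Nat.cast_nonneg i) (Nat.cast_le.2 hij) hs0.le) hat hsum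
  have h4 : Tendsto (fun n : ℕ => G (Y 1 ω, Γ 1 ω) / (n : ℝ) ^ s) atTop (𝓝 0) :=
    hat.const_div_atTop _
  have hlim := hkr.add (h4.sub h3)
  rw [sub_zero, add_zero] at hlim
  refine hlim.congr fun n => ?_
  -- the summand `k = 0` carries the weight `0 ^ s = 0`
  have e : ∑ k ∈ Finset.range (n + 1), (k : ℝ) ^ s *
      (poissonIncrement G h a ((Y k ω, Γ k ω), Y (k + 1) ω) / (k : ℝ) ^ s
        + adaptError G Y Γ k ω / (k : ℝ) ^ s)
      = ∑ j ∈ Finset.Icc 1 n, (poissonIncrement G h a ((Y j ω, Γ j ω), Y (j + 1) ω)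
          + adaptError G Y Γ j ω) := by
    rw [Finset.range_eq_Ico, Finset.sum_eq_sum_Ico_succ_bot n.succ_pos]
    simp only [Nat.cast_zero, Real.zero_rpow hs0.ne', zero_mul, zero_add]
    refine Finset.sum_congr (by ext; simp) fun k hk => ?_
    have hk0 : 0 < k := (Finset.mem_Ico.1 hk).1
    have hk1 : (0 : ℝ) < (k : ℝ) ^ s := Real.rpow_pos_of_pos (by exact_mod_cast hk0) s
    rw [← add_div, mul_div_cancel₀ _ hk1.ne']
  rw [e, sum_sub_eq G h a n ω]
  ring

end IsAIRChain

end Decomposition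

/-! ### Almost sure convergence for AIR chains -/

section Main

variable {𝒳 Φ 𝓘 : Type*} [MeasurableSpace 𝒳] [MeasurableSpace Φ] [MeasurableSpace 𝓘]

theorem HasTarget.map_fst {P : Kernel ((𝒳 × Φ) × 𝓘) (𝒳 × Φ)} {π : 𝓘 → Measure (𝒳 × Φ)}
    {ν : Measure 𝒳} (hπ : HasTarget P π ν) (γ : 𝓘) : (π γ).map Prod.fst = ν := by
  ext B hB
  rw [Measure.map_apply measurable_fst hB, ← hπ.marginal γ B hB]
  congr 1
  ext q
  simp

end Main

end AIRMCMC

theorem mainTheorem5 {𝒳 Φ 𝓘 Ω : Type*}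
    [TopologicalSpace 𝒳] [PolishSpace 𝒳] [MeasurableSpace 𝒳]
    [MeasurableSpace.CountablyGenerated 𝒳]
    [TopologicalSpace Φ] [PolishSpace Φ] [MeasurableSpace Φ]
    [MeasurableSpace.CountablyGenerated Φ]
    [MeasurableSpace 𝓘] [MeasurableSpace Ω]
    (μ : Measure Ω) [IsProbabilityMeasure μ]
    (ν : Measure 𝒳) [IsProbabilityMeasure ν]
    (P : Kernel ((𝒳 × Φ) × 𝓘) (𝒳 × Φ)) [IsMarkovKernel P]
    (π : 𝓘 → Measure (𝒳 × Φ)) (hπ : AIRMCMC.HasTarget P π ν)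
    (V : 𝒳 × Φ → ℝ) (hV : AIRMCMC.DriftMinorisation P V)
    (β : ℝ) (hβ : 0 < β)
    (Y : ℕ → Ω → 𝒳 × Φ) (Γ : ℕ → Ω → 𝓘) (hY : AIRMCMC.IsAIRChain μ P β Y Γ)
    (p : ℝ) (hp : 2 < p)
    (f : 𝒳 → ℝ) (hf : Measurable f) (hfV : ∀ x φ, |f x| ≤ V (x, φ) ^ (1 / p))
    (ε : ℝ) (hε : max 0 (1 / (1 + β) + 1 / p - 1 / 2) < ε) :
    Integrable f ν ∧
    ∀ᵐ ω ∂μ, Tendsto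
      (fun n : ℕ => 1 / (n : ℝ) ^ (1 / 2 + ε) *
        ∑ j ∈ Finset.Icc 1 n, (f (Y j ω).1 - ∫ x, f x ∂ν))
      atTop (𝓝 0) := by
  obtain ⟨-, hVm, hV1, C, κ, δ, b, v, hC, hκ0, hκ1, hδ, -, hγ⟩ := hV
  have hV0 : ∀ y, 0 ≤ V y := fun y => zero_le_one.trans (hV1 y)
  have hp0 : 0 < p := by linarith
  have hprob := hπ.prob
  -- `V ≥ 1` and `p > 2` allow the exponent `1 / p` to be replaced by `1 / 2`
  have hfs : ∀ y : 𝒳 × Φ, |f y.1| ≤ √(V y) := fun y => by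
    rw [Real.sqrt_eq_rpow]
    exact (hfV y.1 y.2).trans
      (Real.rpow_le_rpow_of_exponent_le (hV1 y) (one_div_le_one_div_of_le two_pos hp.le))
  have hfm : Measurable fun y : 𝒳 × Φ => f y.1 := hf.comp measurable_fst
  have hfat : ∀ γ, ∫⁻ y, ENNReal.ofReal ((1 - κ) * V y) ∂π γ ≤ ENNReal.ofReal b * π γ C := fun γ =>
    AIRMCMC.lintegral_invariant_le (hπ.invariant γ) hVm hV0 hC hκ0.le hκ1.le (hγ γ).1
  have hVi : ∀ γ, Integrable V (π γ) := fun γ => by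
    have h1 : Integrable (fun y => (1 - κ) * V y) (π γ) := by
      refine ⟨(hVm.const_mul _).aestronglyMeasurable, ?_⟩
      rw [hasFiniteIntegral_iff_ofReal
        (.of_forall fun y => mul_nonneg (sub_nonneg.2 hκ1.le) (hV0 y))]
      exact (hfat γ).trans_lt (ENNReal.mul_lt_top ENNReal.ofReal_lt_top (measure_lt_top _ _))
    have h2 := h1.const_mul (1 - κ)⁻¹
    simpa only [inv_mul_cancel_left₀ (sub_pos.2 hκ1).ne'] using h2
  have hCpos : ∀ γ, π γ C ≠ 0 := fun γ h0 => by
    have h1 := hfat γ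
    rw [h0, mul_zero, nonpos_iff_eq_zero,
      lintegral_eq_zero_iff (hVm.const_mul _).ennreal_ofReal] at h1
    obtain ⟨y, hy⟩ := h1.exists
    have h2 := ENNReal.ofReal_eq_zero.1 hy
    have h3 := mul_pos (sub_pos.2 hκ1) (zero_lt_one.trans_le (hV1 y))
    linarith
  have hD : ∀ γ, ∃ η, AIRMCMC.GeomDrift (P.sectL γ) (fun y => √(V y)) C η (√κ) (√b) δ := fun γ => by
    obtain ⟨hd, η, hη, hηC, hm⟩ := hγ γ
    exact ⟨η, AIRMCMC.geomDrift_sqrt hVm hV1 hC hκ0 hκ1 hδ hd hηC hm⟩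
  have hVs : ∀ y, √(V y) ≤ V y := fun y =>
    Real.sqrt_le_iff.2 ⟨hV0 y, le_self_pow₀ (hV1 y) two_ne_zero⟩
  have hWi : ∀ γ, Integrable (fun y => √(V y)) (π γ) := fun γ =>
    (hVi γ).mono' hVm.sqrt.aestronglyMeasurable (.of_forall fun y => by
      rw [Real.norm_eq_abs, abs_of_nonneg (Real.sqrt_nonneg _)]
      exact hVs y)
  have hfi : ∀ γ, Integrable (fun y : 𝒳 × Φ => f y.1) (π γ) := fun γ =>
    (hWi γ).mono' hfm.aestronglyMeasurable (.of_forall hfs)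
  obtain ⟨_, γ₀, _⟩ := hY.initial
  refine ⟨?_, ?_⟩
  · rw [← hπ.map_fst γ₀]
    exact (integrable_map_measure hf.aestronglyMeasurable measurable_fst.aemeasurable).2 (hfi γ₀)
  have ha : ∀ γ, ∫ y, f y.1 ∂π γ = ∫ x, f x ∂ν := fun γ => by
    rw [← hπ.map_fst γ, integral_map measurable_fst.aemeasurable hf.aestronglyMeasurable]
  obtain ⟨K, G, hG, hGK, hGi, hGP⟩ :=
    AIRMCMC.exists_poisson_family hD hπ.invariant hWi hCpos hfm hfs ha
  obtain ⟨B, hB⟩ := hY.exists_integral_le hVm hV0 hκ0.le hκ1 fun q => (hγ q.2).1 q.1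
  have hε0 : 0 < ε := (le_max_left _ _).trans_lt hε
  have hε1 : 1 / (1 + β) + 1 / p - 1 / 2 < ε := (le_max_right _ _).trans_lt hε
  have hp1 : 0 < 1 / p := by positivity
  refine hY.ae_tendsto_ergodic_sum hV1 hB hG (abs_nonneg K)
    (fun q => (hGK q).trans (mul_le_mul_of_nonneg_right (le_abs_self K) (Real.sqrt_nonneg _)))
    hfm hfs hGi hGP hβ (by linarith) ?_
  have h1 : 1 / (1 + β) < 1 / 2 + ε := by linarith
  rwa [div_lt_iff₀' (by positivity)] at h1
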